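/- A boolean cellular automaton $B$ with $n$ gates assigns to each gate $i\in\{1,\dots,n\}$ two distinct inputs $j_i<k_i$ in $\{1,\dots,n\}$ and a function $f_i:\{0,1\}^2\to\{0,1\}$. It acts on states $x\in\{0,1\}^n$ by $B(x)_i=f_i(x_{j_i},x_{k_i})$. For an initial state $x$, let $t_1$ be the first time for which there is $t_0<t_1$ with $B^{t_0}(x)=B^{t_1}(x)$. The tail of $x$ is the set $\{B^t(x):t<t_0\}$ of the states visited before the state cycle $\{B^t(x):t\ge t_0\}$ is entered, and its length is its number of elements. A function $f:\{0,1\}^2\to\{0,1\}$ is canalyzing if fixing some one of its arguments to some value makes $f$ constant. Let $\mathcal A$ be the set of the two constant functions, $\mathcal B_1$ and $\mathcal B_2$ the sets of the canalyzing functions that depend on exactly one and on both arguments respectively, and $\mathcal C$ the set of the two non-canalyzing functions. Let $(a_f)_f$ be a probability distribution on the 16 functions $f:\{0,1\}^2\to\{0,1\}$ with $a_f=a_{\neg f}$ for all $f\in\mathcal A\cup\mathcal B_2$ and $a_{f(x,y)}=a_{f(y,x)}$ for all $f\in\mathcal B_1$. Put $a=\sum_{f\in\mathcal A}a_f$ and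 $c=\sum_{f\in\mathcal C}a_f$. For $n\ge 2$, let $\tilde B_n$ be the random automaton with $n$ gates in which, independently for all gates, the pair of inputs is uniform among the $\binom n2$ two-element subsets of $\{1,\dots,n\}$ and, independently of it, the function is $f$ with probability $a_f$. **Theorem.** If $a>c$, then there is a constant $\beta$ such that $$\lim_{n\to\infty}\Pr\bigl(\text{some initial state of }\tilde B_n\text{ has a tail longer than }\beta\log_2 n\bigr)=0 .$$ -/

import Mathlib

open Filter Topology

namespace BoolCA

/-- Boolean functions of two arguments (`false` is 0, `true` is 1). -/
abbrev BoolFun : Type := Bool → Bool → Bool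

/-- `f` depends on its first argument. -/
def DependsFst (f : BoolFun) : Prop := ∃ v, f false v ≠ f true v

/-- `f` depends on its second argument. -/
def DependsSnd (f : BoolFun) : Prop := ∃ v, f v false ≠ f v true

/-- `f` is canalyzing: some value `u` of one of the arguments forces the value `v` of `f`. -/
def Canalyzing (f : BoolFun) : Prop :=
  ∃ u v, (∀ y, f u y = v) ∨ (∀ x, f x u = v)

instance : DecidablePred DependsFst := fun f => by unfold DependsFst; infer_instance
instance : DecidablePred DependsSnd := fun f => by unfold DependsSnd; infer_instance
instance : DecidablePred Canalyzing := fun f => by unfold Canalyzing; infer_instance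

/-- The two constant functions. -/
def classA : Finset BoolFun := {f | ∃ v, ∀ x y, f x y = v}

/-- The canalyzing functions that depend on exactly one argument. -/
def classB₁ : Finset BoolFun := {f | Canalyzing f ∧ ¬ (DependsFst f ↔ DependsSnd f)}

/-- The canalyzing functions that depend on both arguments. -/
def classB₂ : Finset BoolFun := {f | Canalyzing f ∧ DependsFst f ∧ DependsSnd f}

/-- The non-canalyzing functions. -/
def classC : Finset BoolFun := {f | ¬ Canalyzing f}

/-- A probability distribution `⟨a_f⟩` on the boolean functions of two arguments that satisfies
the symmetry conditions `a_f = a_{¬f}` on `𝒜 ∪ ℬ₂` and `a_{f(x,y)} = a_{f(y,x)}` on `ℬ₁`. -/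
structure IsSymmetricDistribution (a : BoolFun → ℝ) : Prop where
  nonneg : ∀ f, 0 ≤ a f
  sum_eq_one : ∑ f, a f = 1
  neg_symm : ∀ f ∈ classA ∪ classB₂, a f = a (fun x y => !(f x y))
  swap_symm : ∀ f ∈ classB₁, a f = a (fun x y => f y x)

/-- The possible (unordered) pairs of distinct inputs of a gate, listed in increasing order.
A gate may be an input of itself. -/
abbrev InputPair (n : ℕ) : Type := {p : Fin n × Fin n // p.1 < p.2}

/-- A boolean cellular automaton with `n` gates, all of indegree two: each gate `i` is given
its two inputs `j_i < k_i` and its boolean function `f_i`. -/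
abbrev Automaton (n : ℕ) : Type := Fin n → InputPair n × BoolFun

variable {n : ℕ}

/-- The map `B : {0,1}ⁿ → {0,1}ⁿ`, `B(x)_i = f_i(x_{j_i}, x_{k_i})`. -/
def Automaton.step (B : Automaton n) (x : Fin n → Bool) : Fin n → Bool :=
  fun i => (B i).2 (x (B i).1.val.1) (x (B i).1.val.2)

/-- The state of `B` at time `t` when the initial state is `x`. -/
def Automaton.state (B : Automaton n) (x : Fin n → Bool) (t : ℕ) : Fin n → Bool :=
  B.step^[t] x

theorem Automaton.exists_repeat (B : Automaton n) (x : Fin n → Bool) :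
    ∃ t₁, ∃ t₀, t₀ < t₁ ∧ B.state x t₀ = B.state x t₁ := by
  obtain ⟨s, t, hne, h⟩ := Finite.exists_ne_map_eq_of_infinite (B.state x)
  rcases lt_or_gt_of_ne hne with hlt | hlt
  · exact ⟨t, s, hlt, h⟩
  · exact ⟨s, t, hlt, h.symm⟩

open Classical in
/-- The first time `t₁` at which a state occurs that has occurred before. -/
noncomputable def Automaton.repeatTime (B : Automaton n) (x : Fin n → Bool) : ℕ :=
  Nat.find (B.exists_repeat x)

theorem Automaton.exists_entry (B : Automaton n) (x : Fin n → Bool) :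
    ∃ t₀, t₀ < B.repeatTime x ∧ B.state x t₀ = B.state x (B.repeatTime x) := by
  classical
  exact Nat.find_spec (B.exists_repeat x)

open Classical in
/-- The time `t₀ < t₁` at which the state at time `t₁` occurred before, i.e. the time at which
the state cycle of `x` is entered. -/
noncomputable def Automaton.entryTime (B : Automaton n) (x : Fin n → Bool) : ℕ :=
  Nat.find (B.exists_entry x)

/-- The tail of `x` in `B`: the set of the states at the times `t < t₀`. -/
def Automaton.tail (B : Automaton n) (x : Fin n → Bool) : Set (Fin n → Bool) :=
  {y | ∃ t, t < B.entryTime x ∧ B.state x t = y}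

/-- Some initial state has a tail with more than `r` states. -/
def Automaton.HasTailLongerThan (B : Automaton n) (r : ℝ) : Prop :=
  ∃ x, r < ((B.tail x).ncard : ℝ)

/-- The probability that the random automaton is `B`: independently for every gate, the pair of
inputs is uniform among the `n.choose 2` possible pairs, and, independently of that, the boolean
function is `f` with probability `a f`. -/
noncomputable def Automaton.prob (a : BoolFun → ℝ) (B : Automaton n) : ℝ :=
  ∏ i, ((n.choose 2 : ℝ)⁻¹ * a (B i).2)

open Classical in
/-- The probability that the random automaton with `n` gates has the property `P`
(there is no random automaton for `n = 1`, and the value is then 0). -/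
noncomputable def pr (a : BoolFun → ℝ) (n : ℕ) (P : Automaton n → Prop) : ℝ :=
  ∑ B : Automaton n with P B, B.prob a

end BoolCA

namespace BoolCA

variable {n : ℕ} {a : BoolFun → ℝ}

/-! Put s = 1 - a + c, the mean number of arguments to which a random function is sensitive at a
uniform point; the hypothesis says s < 1. After a fixed number d of steps, the values of most gates
are enforced whatever the initial state was. What remains undetermined travels only along live
inputs, which form a subcritical random digraph.

Enforced values are recorded by `status`. Locally the automaton looks like a tree, so the
proportions of the statuses follow the recursion `limitStatus`. The negation symmetry on 𝒜 ∪ ℬ₂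
keeps the values 0 and 1 equally likely, and then the proportion of unknown gates shrinks by the
factor s in each step (`nextStatus_symm`, `nextStatus_none_le`). A second moment estimate, with a
polylogarithmic bound on outdegrees, shows that the actual proportions are close to these limits
(`tendsto_pr_not_balanced`). Since inputs are listed in increasing order, this is needed on every
initial segment of the gates; the swap symmetry on ℬ₁ then makes the position of a gate irrelevant
(`sum_live_eq`). Thus a given gate is a live input of a random gate with probability at most q/n,
where q < 1.

A first moment computation excludes, with high probability, simple live paths with more than L =
O(log n) vertices, and bicycles: simple paths with two additional edges, one into the first vertex
and one out of the last (`pr_hasPath_le`, `pr_hasBicycle_le`). The statuses depend on the very gates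
of the path. Therefore these gates are declared unknown: the statuses then ignore them, live inputs
stay live, and few statuses change.

The rest is deterministic. Without long paths and bicycles, a vertex on a cycle has just one
in-neighbour to which a cycle leads, so in the long run each cycle merely transports its own values,
and all gates are periodic after 3L further steps (`Propagates.eventually_periodic`). Every tail has
length at most d + 3L. -/

/-! ### Means and probabilities over independent random gates -/

/-- The choice made at a single gate: a pair of inputs and a boolean function. -/
abbrev Gate (n : ℕ) : Type := InputPair n × BoolFun

/-- The probability of a choice at a single gate. -/
noncomputable def gateWeight (a : BoolFun → ℝ) (g : Gate n) : ℝ := (n.choose 2 : ℝ)⁻¹ * a g.2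

/-- The mean of a function of a random gate. -/
noncomputable def gateMean (a : BoolFun → ℝ) (ψ : Gate n → ℝ) : ℝ := ∑ g, gateWeight a g * ψ g

/-- The mean of a function of the random automaton. -/
noncomputable def expect (a : BoolFun → ℝ) (X : Automaton n → ℝ) : ℝ := ∑ B, B.prob a * X B

open Classical in
/-- The real-valued indicator of a proposition. -/
noncomputable def ind (p : Prop) : ℝ := if p then 1 else 0

/-- `X` does not depend on the gates in `P`. -/
def Ignores {γ : Type*} (P : Finset (Fin n)) (X : Automaton n → γ) : Prop :=
  ∀ v ∈ P, ∀ B g, X (Function.update B v g) = X B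

@[simp] theorem ind_true {p : Prop} (h : p) : ind p = 1 := by simp [ind, h]
@[simp] theorem ind_false {p : Prop} (h : ¬ p) : ind p = 0 := by simp [ind, h]

theorem ind_nonneg (p : Prop) : 0 ≤ ind p := by unfold ind; split_ifs <;> norm_num

theorem ind_le_one (p : Prop) : ind p ≤ 1 := by unfold ind; split_ifs <;> norm_num

theorem ind_and (p q : Prop) : ind (p ∧ q) = ind p * ind q := by
  unfold ind; by_cases hp : p <;> by_cases hq : q <;> simp [hp, hq]

theorem ind_mono {p q : Prop} (h : p → q) : ind p ≤ ind q := by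
  by_cases hp : p
  · simp [hp, h hp]
  · simpa [hp] using ind_nonneg q

theorem ind_or_le (p q : Prop) : ind (p ∨ q) ≤ ind p + ind q := by
  by_cases hp : p
  · simpa [hp] using ind_nonneg q
  · rw [ind_false hp, zero_add]
    exact ind_mono fun h => h.resolve_left hp

theorem ind_exists_le_sum {ι : Type*} (s : Finset ι) (p : ι → Prop) :
    ind (∃ i ∈ s, p i) ≤ ∑ i ∈ s, ind (p i) := by
  by_cases h : ∃ i ∈ s, p i
  · obtain ⟨i, hi, hp⟩ := h
    rw [ind_true ⟨i, hi, hp⟩, ← ind_true hp]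
    exact Finset.single_le_sum (f := fun i => ind (p i)) (fun j _ => ind_nonneg _) hi
  · rw [ind_false h]
    exact Finset.sum_nonneg fun i _ => ind_nonneg _

/-- A sum over pairs of inputs as an iterated sum. -/
theorem sum_inputPair (F : Fin n → Fin n → ℝ) :
    ∑ p : InputPair n, F p.val.1 p.val.2 = ∑ k : Fin n, ∑ j with j < k, F j k := by
  classical
  rw [← Finset.sum_subtype (s := (Finset.univ.filter fun p : Fin n × Fin n => p.1 < p.2))
    (f := fun p => F p.1 p.2) (fun p => by simp)]
  rw [Finset.sum_filter, Fintype.sum_prod_type, Finset.sum_comm]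
  simp_rw [Finset.sum_filter]

theorem card_inputPair (n : ℕ) : (Fintype.card (InputPair n) : ℝ) = n.choose 2 := by
  have h := sum_inputPair (n := n) (fun _ _ => (1 : ℝ))
  simp only [Finset.sum_const, nsmul_eq_mul, mul_one, Finset.card_univ] at h
  rw [h]
  have : ∀ k : Fin n, (Finset.univ.filter fun j : Fin n => j < k).card = k.val := by
    intro k; simp [Finset.filter_gt_eq_Iio]
  simp_rw [this]
  rw [Fin.sum_univ_eq_sum_range (fun i => (i : ℝ)), Nat.choose_two_right, ← Finset.sum_range_id]
  push_cast; rfl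

theorem choose_two_pos (hn : 2 ≤ n) : (0 : ℝ) < n.choose 2 := by
  exact_mod_cast Nat.choose_pos hn

theorem choose_two_eq (n : ℕ) : (n.choose 2 : ℝ) = n * (n - 1) / 2 := by
  rw [Nat.cast_choose_two]

theorem gateWeight_nonneg (ha : IsSymmetricDistribution a) (g : Gate n) : 0 ≤ gateWeight a g :=
  mul_nonneg (by positivity) (ha.nonneg _)

theorem gateMean_eq (ψ : Gate n → ℝ) :
    gateMean a ψ = ∑ f, a f * ((n.choose 2 : ℝ)⁻¹ * ∑ p : InputPair n, ψ (p, f)) := by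
  unfold gateMean gateWeight
  rw [Fintype.sum_prod_type_right]
  refine Finset.sum_congr rfl fun f _ => ?_
  rw [Finset.mul_sum, Finset.mul_sum]
  exact Finset.sum_congr rfl fun p _ => by ring

theorem gateMean_const (ha : IsSymmetricDistribution a) (hn : 2 ≤ n) (c : ℝ) :
    gateMean (n := n) a (fun _ => c) = c := by
  rw [gateMean_eq]
  simp only [Finset.sum_const, Finset.card_univ, nsmul_eq_mul, card_inputPair]
  have := (choose_two_pos hn).ne'
  simp_rw [inv_mul_cancel_left₀ this]
  rw [← Finset.sum_mul, ha.sum_eq_one, one_mul]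

theorem gateMean_mono (ha : IsSymmetricDistribution a) {ψ φ : Gate n → ℝ} (h : ∀ g, ψ g ≤ φ g) :
    gateMean a ψ ≤ gateMean a φ :=
  Finset.sum_le_sum fun g _ => mul_le_mul_of_nonneg_left (h g) (gateWeight_nonneg ha g)

theorem gateMean_add (ψ φ : Gate n → ℝ) :
    gateMean a (fun g => ψ g + φ g) = gateMean a ψ + gateMean a φ := by
  simp [gateMean, mul_add, Finset.sum_add_distrib]

theorem gateMean_sub (ψ φ : Gate n → ℝ) :
    gateMean a (fun g => ψ g - φ g) = gateMean a ψ - gateMean a φ := by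
  simp [gateMean, mul_sub, Finset.sum_sub_distrib]

theorem gateMean_mul_left (c : ℝ) (ψ : Gate n → ℝ) :
    gateMean a (fun g => c * ψ g) = c * gateMean a ψ := by
  unfold gateMean; rw [Finset.mul_sum]; exact Finset.sum_congr rfl fun _ _ => by ring

theorem gateMean_mul_right (c : ℝ) (ψ : Gate n → ℝ) :
    gateMean a (fun g => ψ g * c) = gateMean a ψ * c := by
  unfold gateMean; rw [Finset.sum_mul]; exact Finset.sum_congr rfl fun _ _ => by ring

theorem gateMean_sum {ι : Type*} (s : Finset ι) (ψ : ι → Gate n → ℝ) :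
    gateMean a (fun g => ∑ i ∈ s, ψ i g) = ∑ i ∈ s, gateMean a (ψ i) := by
  unfold gateMean; simp_rw [Finset.mul_sum]; exact Finset.sum_comm

theorem gateMean_nonneg (ha : IsSymmetricDistribution a) {ψ : Gate n → ℝ} (h : ∀ g, 0 ≤ ψ g) :
    0 ≤ gateMean a ψ :=
  Finset.sum_nonneg fun g _ => mul_nonneg (gateWeight_nonneg ha g) (h g)

theorem gateMean_abs_le (ha : IsSymmetricDistribution a) (ψ : Gate n → ℝ) :
    |gateMean a ψ| ≤ gateMean a (fun g => |ψ g|) := by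
  refine (Finset.abs_sum_le_sum_abs _ _).trans (Finset.sum_le_sum fun g _ => ?_)
  rw [abs_mul, abs_of_nonneg (gateWeight_nonneg ha g)]

theorem prob_eq (B : Automaton n) : B.prob a = ∏ i, gateWeight a (B i) := rfl

theorem prob_nonneg (ha : IsSymmetricDistribution a) (B : Automaton n) : 0 ≤ B.prob a :=
  Finset.prod_nonneg fun i _ => gateWeight_nonneg ha (B i)

/-- The mean of a product of functions of the single gates. -/
theorem expect_prod (ψ : Fin n → Gate n → ℝ) :
    expect a (fun B => ∏ i, ψ i (B i)) = ∏ i, gateMean a (ψ i) := by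
  unfold expect gateMean
  rw [Finset.prod_univ_sum, Fintype.piFinset_univ]
  exact Finset.sum_congr rfl fun B _ => by rw [prob_eq, Finset.prod_mul_distrib]

theorem expect_const (ha : IsSymmetricDistribution a) (hn : 2 ≤ n) (c : ℝ) :
    expect (n := n) a (fun _ => c) = c := by
  have h : expect (n := n) a (fun _ => 1) = 1 := by
    simpa [gateMean_const ha hn] using expect_prod (a := a) (n := n) (fun _ _ => 1)
  unfold expect at h ⊢
  rw [← Finset.sum_mul]
  simp only [mul_one] at h
  rw [h, one_mul]

theorem expect_mono (ha : IsSymmetricDistribution a) {X Y : Automaton n → ℝ}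
    (h : ∀ B, X B ≤ Y B) : expect a X ≤ expect a Y :=
  Finset.sum_le_sum fun B _ => mul_le_mul_of_nonneg_left (h B) (prob_nonneg ha B)

theorem expect_add (X Y : Automaton n → ℝ) :
    expect a (fun B => X B + Y B) = expect a X + expect a Y := by
  simp [expect, mul_add, Finset.sum_add_distrib]

theorem expect_mul_left (c : ℝ) (X : Automaton n → ℝ) :
    expect a (fun B => c * X B) = c * expect a X := by
  unfold expect; rw [Finset.mul_sum]; exact Finset.sum_congr rfl fun _ _ => by ring

theorem expect_mul_right (c : ℝ) (X : Automaton n → ℝ) :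
    expect a (fun B => X B * c) = expect a X * c := by
  unfold expect; rw [Finset.sum_mul]; exact Finset.sum_congr rfl fun _ _ => by ring

theorem expect_sum {ι : Type*} (s : Finset ι) (X : ι → Automaton n → ℝ) :
    expect a (fun B => ∑ i ∈ s, X i B) = ∑ i ∈ s, expect a (X i) := by
  unfold expect; simp_rw [Finset.mul_sum]; exact Finset.sum_comm

theorem expect_nonneg (ha : IsSymmetricDistribution a) {X : Automaton n → ℝ} (h : ∀ B, 0 ≤ X B) :
    0 ≤ expect a X :=
  Finset.sum_nonneg fun B _ => mul_nonneg (prob_nonneg ha B) (h B)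

theorem pr_eq (P : Automaton n → Prop) : pr a n P = expect a (fun B => ind (P B)) := by
  classical
  unfold pr expect ind
  rw [Finset.sum_filter]
  refine Finset.sum_congr rfl fun B _ => ?_
  by_cases h : P B <;> simp [h]

theorem pr_nonneg (ha : IsSymmetricDistribution a) (P : Automaton n → Prop) : 0 ≤ pr a n P := by
  rw [pr_eq]; exact expect_nonneg ha fun B => ind_nonneg _

theorem pr_mono (ha : IsSymmetricDistribution a) {P Q : Automaton n → Prop}
    (h : ∀ B, P B → Q B) : pr a n P ≤ pr a n Q := by
  rw [pr_eq, pr_eq]; exact expect_mono ha fun B => ind_mono (h B)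

theorem pr_or_le (ha : IsSymmetricDistribution a) (P Q : Automaton n → Prop) :
    pr a n (fun B => P B ∨ Q B) ≤ pr a n P + pr a n Q := by
  simp only [pr_eq]
  rw [← expect_add]; exact expect_mono ha fun B => ind_or_le _ _

theorem pr_exists_le_sum (ha : IsSymmetricDistribution a) {ι : Type*} (s : Finset ι)
    (P : ι → Automaton n → Prop) :
    pr a n (fun B => ∃ i ∈ s, P i B) ≤ ∑ i ∈ s, pr a n (P i) := by
  simp only [pr_eq]
  rw [← expect_sum]; exact expect_mono ha fun B => ind_exists_le_sum _ _

/-- Stated without division, since the weight of a gate may vanish. -/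
theorem prob_update (B : Automaton n) (v : Fin n) (g : Gate n) :
    Automaton.prob a (Function.update B v g) * gateWeight a (B v) = B.prob a * gateWeight a g := by
  classical
  rw [prob_eq, prob_eq, ← Finset.mul_prod_erase _ _ (Finset.mem_univ v),
    ← Finset.mul_prod_erase (Finset.univ) (fun i => gateWeight a (B i)) (Finset.mem_univ v)]
  have : ∏ x ∈ Finset.univ.erase v, gateWeight a (Function.update B v g x)
      = ∏ x ∈ Finset.univ.erase v, gateWeight a (B x) :=
    Finset.prod_congr rfl fun x hx => by rw [Function.update_of_ne (Finset.ne_of_mem_erase hx)]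
  rw [this, Function.update_self]
  ring

/-- Choosing the gate `v` a second time does not change means. -/
theorem expect_resample (ha : IsSymmetricDistribution a) (hn : 2 ≤ n) (v : Fin n)
    (Y : Automaton n → ℝ) :
    expect a Y = expect a (fun B => gateMean a (fun g => Y (Function.update B v g))) := by
  have h1 : expect a Y = ∑ q : Automaton n × Gate n, q.1.prob a * gateWeight a q.2 * Y q.1 := by
    rw [Fintype.sum_prod_type]
    unfold expect
    refine Finset.sum_congr rfl fun B _ => ?_
    have := gateMean_const ha hn (Y B)
    unfold gateMean at this
    conv_lhs => rw [← this, Finset.mul_sum]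
    exact Finset.sum_congr rfl fun g _ => by ring
  have h2 : expect a (fun B => gateMean a (fun g => Y (Function.update B v g)))
      = ∑ q : Automaton n × Gate n,
        q.1.prob a * gateWeight a q.2 * Y (Function.update q.1 v q.2) := by
    rw [Fintype.sum_prod_type]
    unfold expect gateMean
    refine Finset.sum_congr rfl fun B _ => ?_
    rw [Finset.mul_sum]
    exact Finset.sum_congr rfl fun g _ => by ring
  rw [h1, h2]
  -- Exchanging the gate at `v` with the fresh one is an involution that preserves the joint weight.
  let e : Automaton n × Gate n → Automaton n × Gate n :=
    fun q => (Function.update q.1 v q.2, q.1 v)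
  have he : Function.Involutive e := fun q => by simp [e]
  refine Fintype.sum_equiv (Function.Involutive.toPerm e he) _ _ fun q => ?_
  have : Function.Involutive.toPerm e he q = e q := rfl
  rw [this]
  simp only [e, prob_update]
  simp

/-- If the event `good` and the constraints on distinct gates in `P` do not depend on the gates in
`P`, then the probabilities that these gates satisfy their constraints multiply. -/
theorem pr_forall_le_prod (ha : IsSymmetricDistribution a) (hn : 2 ≤ n) {ι : Type*} [Fintype ι]
    {w : ι → Fin n} (hw : Function.Injective w) {P : Finset (Fin n)} (hwP : ∀ i, w i ∈ P)
    {good : Automaton n → Prop} {con : ι → Automaton n → Gate n → Prop} {c : ι → ℝ}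
    (hgood : Ignores P good) (hcon : ∀ i, Ignores P (con i))
    (hc : ∀ B, good B → ∀ i, gateMean a (fun g => ind (con i B g)) ≤ c i)
    (hc0 : ∀ i, 0 ≤ c i) :
    pr a n (fun B => good B ∧ ∀ i, con i B (B (w i))) ≤ ∏ i, c i := by
  classical
  -- Induction on the set of constrained gates, choosing one of them anew each time: by injectivity
  -- of `w`, the new choice affects neither `good` nor the other constraints.
  suffices H : ∀ Q : Finset ι,
      pr a n (fun B => good B ∧ ∀ i ∈ Q, con i B (B (w i))) ≤ ∏ i ∈ Q, c i by
    simpa using H Finset.univ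
  intro Q
  induction Q using Finset.induction_on with
  | empty =>
    rw [pr_eq, Finset.prod_empty]
    calc _ ≤ expect a (fun _ : Automaton n => (1 : ℝ)) := expect_mono ha fun B => ind_le_one _
      _ = 1 := expect_const ha hn 1
  | insert v Q hvQ ih =>
    rw [pr_eq, expect_resample ha hn (w v), Finset.prod_insert hvQ, mul_comm]
    refine le_trans ?_ (mul_le_mul_of_nonneg_right ih (hc0 v))
    rw [pr_eq, ← expect_mul_right]
    refine expect_mono ha fun B => ?_
    have key : ∀ g, ind (good (Function.update B (w v) g) ∧ ∀ i ∈ insert v Q,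
        con i (Function.update B (w v) g) (Function.update B (w v) g (w i)))
        = ind (good B ∧ ∀ i ∈ Q, con i B (B (w i))) * ind (con v B g) := by
      intro g
      rw [← ind_and]
      congr 1
      rw [Finset.forall_mem_insert, hgood _ (hwP v), hcon v _ (hwP v), Function.update_self]
      have : (∀ i ∈ Q, con i (Function.update B (w v) g) (Function.update B (w v) g (w i)))
          ↔ ∀ i ∈ Q, con i B (B (w i)) := by
        refine forall₂_congr fun i hi => ?_
        rw [hcon i _ (hwP v), Function.update_of_ne]
        intro h
        exact hvQ (hw h ▸ hi)
      rw [this]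
      apply propext; tauto
    simp_rw [key]
    rw [gateMean_mul_left]
    by_cases hg : good B
    · exact mul_le_mul_of_nonneg_left (hc B hg v) (ind_nonneg _)
    · simp [hg]

/-! ### Enforced statuses and the effect of leaving out gates -/

/-- The value `x` is possible for a gate with status `β`: `some b` means that the gate is
known to have the value `b`, and `none` that nothing is known about it. -/
def Compat (β : Option Bool) (x : Bool) : Prop := ∀ b, β = some b → x = b

instance (β : Option Bool) (x : Bool) : Decidable (Compat β x) := by
  unfold Compat; infer_instance

theorem compat_exists (β : Option Bool) : ∃ x, Compat β x := by
  cases β with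
  | none => exact ⟨true, fun b h => by cases h⟩
  | some b => exact ⟨b, fun c h => by cases h; rfl⟩

/-- The status of a gate with function `f` whose inputs have the statuses `β` and `γ`. -/
def force (f : BoolFun) (β γ : Option Bool) : Option Bool :=
  if ∀ x y, Compat β x → Compat γ y → f x y = true then some true
  else if ∀ x y, Compat β x → Compat γ y → f x y = false then some false
  else none

/-- Compatible arguments always exist, so the two branches of `force` cannot both apply. -/
theorem force_eq_some_iff {f : BoolFun} {β γ : Option Bool} {v : Bool} :
    force f β γ = some v ↔ ∀ x y, Compat β x → Compat γ y → f x y = v := by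
  obtain ⟨x₀, hx₀⟩ := compat_exists β
  obtain ⟨y₀, hy₀⟩ := compat_exists γ
  unfold force
  split_ifs with h1 h2
  · cases v
    · simp only [Option.some.injEq, Bool.true_eq_false, false_iff]
      intro h
      have := h x₀ y₀ hx₀ hy₀
      rw [h1 x₀ y₀ hx₀ hy₀] at this
      cases this
    · simpa using h1
  · cases v
    · simpa using h2
    · simp only [Option.some.injEq, Bool.false_eq_true, false_iff]
      exact h1
  · cases v <;> simp_all

/-- The gates in `R` are considered unknown throughout; the status of any other gate at time
`τ + 1` is what the statuses of its inputs at time `τ` enforce. -/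
def status (B : Automaton n) (R : Finset (Fin n)) : ℕ → Fin n → Option Bool
  | 0, _ => none
  | τ + 1, i => if i ∈ R then none
      else force (B i).2 (status B R τ (B i).1.val.1) (status B R τ (B i).1.val.2)

/-- The gates whose statuses at time `τ` can be affected by leaving out the gates in `R`. -/
def reach (B : Automaton n) (R : Finset (Fin n)) : ℕ → Finset (Fin n)
  | 0 => ∅
  | τ + 1 => R ∪ Finset.univ.filter fun i =>
      i ∉ R ∧ ((B i).1.val.1 ∈ reach B R τ ∨ (B i).1.val.2 ∈ reach B R τ)

/-- The recursion never consults a gate in `R`. This is the source of independence in all later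
estimates. -/
theorem status_ignores (R : Finset (Fin n)) (τ : ℕ) :
    Ignores R (fun B : Automaton n => status B R τ) := by
  intro v hv B g
  induction τ with
  | zero => rfl
  | succ τ ih =>
    funext i
    simp only [status]
    by_cases hi : i ∈ R
    · simp [hi]
    · have : i ≠ v := by rintro rfl; exact hi hv
      simp only at ih
      simp only [hi, if_false, Function.update_of_ne this, ih]

theorem reach_ignores (R : Finset (Fin n)) (τ : ℕ) :
    Ignores R (fun B : Automaton n => reach B R τ) := by
  intro v hv B g
  induction τ with
  | zero => rfl
  | succ τ ih =>
    ext i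
    simp only [reach, Finset.mem_union, Finset.mem_filter, Finset.mem_univ, true_and]
    by_cases hi : i ∈ R
    · simp [hi]
    · have : i ≠ v := by rintro rfl; exact hi hv
      simp only at ih
      simp only [Function.update_of_ne this, ih]

theorem status_eq_of_notMem_reach (B : Automaton n) (R : Finset (Fin n)) (τ : ℕ) :
    ∀ i, i ∉ reach B R τ → status B R τ i = status B ∅ τ i := by
  induction τ with
  | zero => intro i _; rfl
  | succ τ ih =>
    intro i hi
    simp only [reach, Finset.mem_union, Finset.mem_filter, Finset.mem_univ, true_and,
      not_or, not_and] at hi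
    obtain ⟨h1, h2⟩ := hi
    obtain ⟨h3, h4⟩ := h2 h1
    simp [status, h1, ih _ h3, ih _ h4]

/-- Leaving out gates only loses knowledge. Hence an input that may matter still may matter
afterwards. -/
theorem status_eq_some_of_leave_out (B : Automaton n) (R : Finset (Fin n)) (τ : ℕ) :
    ∀ i b, status B R τ i = some b → status B ∅ τ i = some b := by
  induction τ with
  | zero => intro i b h; cases h
  | succ τ ih =>
    intro i b h
    simp only [status] at h ⊢
    split_ifs at h with hi
    simp only [Finset.notMem_empty, if_false]
    rw [force_eq_some_iff] at h ⊢
    exact fun x y hx hy => h x y (fun c hc => hx c (ih _ _ hc)) (fun c hc => hy c (ih _ _ hc))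

theorem Compat.leave_out {B : Automaton n} (R : Finset (Fin n)) {τ : ℕ} {i : Fin n} {x : Bool}
    (h : Compat (status B ∅ τ i) x) : Compat (status B R τ i) x :=
  fun b hb => h b (status_eq_some_of_leave_out B R τ i b hb)

/-! ### Inputs and outdegrees -/

/-- The gate `t` is an input. -/
def HasInput (g : Gate n) (t : Fin n) : Prop := g.1.val.1 = t ∨ g.1.val.2 = t

instance (g : Gate n) (t : Fin n) : Decidable (HasInput g t) := by
  unfold HasInput; infer_instance

/-- The number of gates outside `R` that have the input `t`. -/
def outdeg (B : Automaton n) (R : Finset (Fin n)) (t : Fin n) : ℕ :=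
  (Finset.univ.filter fun i => i ∉ R ∧ HasInput (B i) t).card

/-- No gate is an input of more than `D` gates. -/
def SmallOutdegree (D : ℕ) (B : Automaton n) : Prop := ∀ t, outdeg B ∅ t ≤ D

/-- In each step, the new set consists of `R` and of at most `D` successors of each old element. -/
theorem card_reach_le {D : ℕ} {B : Automaton n} (h : SmallOutdegree D B) (R : Finset (Fin n))
    (τ : ℕ) : (reach B R τ).card ≤ R.card * (1 + D) ^ τ := by
  induction τ with
  | zero => simp [reach]
  | succ τ ih =>
    have hsub : reach B R (τ + 1) ⊆ R ∪ (reach B R τ).biUnion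
        (fun t => Finset.univ.filter fun i => i ∉ (∅ : Finset (Fin n)) ∧ HasInput (B i) t) := by
      intro i hi
      simp only [reach, Finset.mem_union, Finset.mem_filter, Finset.mem_univ, true_and,
        Finset.mem_biUnion, Finset.notMem_empty, not_false_eq_true] at hi ⊢
      rcases hi with hi | ⟨_, hi | hi⟩
      · exact Or.inl hi
      · exact Or.inr ⟨_, hi, Or.inl rfl⟩
      · exact Or.inr ⟨_, hi, Or.inr rfl⟩
    calc (reach B R (τ + 1)).card ≤ R.card + (reach B R τ).card * D := by
          refine (Finset.card_le_card hsub).trans ((Finset.card_union_le _ _).trans ?_)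
          exact Nat.add_le_add_left (Finset.card_biUnion_le_card_mul _ _ _ fun t _ => h t) _
      _ ≤ R.card * (1 + D) ^ τ + R.card * (1 + D) ^ τ * D := by
          refine Nat.add_le_add (Nat.le_mul_of_pos_right _ (by positivity))
            (Nat.mul_le_mul_right _ ih)
      _ = R.card * (1 + D) ^ (τ + 1) := by ring

theorem card_fin_lt (k : Fin n) : (Finset.univ.filter fun j : Fin n => j < k).card = k.val := by
  simp [Finset.filter_gt_eq_Iio]

theorem card_fin_gt (k : Fin n) :
    (Finset.univ.filter fun j : Fin n => k < j).card = n - 1 - k.val := by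
  simp [Finset.filter_lt_eq_Ioi]

/-- A sum over the pairs of inputs that contain `t`. -/
theorem sum_inputPair_mem (t : Fin n) (F G : Fin n → ℝ) :
    ∑ p : InputPair n, ((if p.val.1 = t then F p.val.2 else 0)
      + (if p.val.2 = t then G p.val.1 else 0))
      = ∑ k with t < k, F k + ∑ j with j < t, G j := by
  rw [Finset.sum_add_distrib]
  congr 1
  · rw [sum_inputPair (fun j k => if j = t then F k else 0), Finset.sum_filter]
    refine Finset.sum_congr rfl fun k _ => ?_
    rw [Finset.sum_ite_eq']
    simp
  · rw [sum_inputPair (fun j k => if k = t then G j else 0)]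
    rw [Finset.sum_eq_single t]
    · simp
    · intro k _ hk; simp [hk]
    · simp

theorem ind_hasInput (g : Gate n) (t : Fin n) :
    ind (HasInput g t) = (if g.1.val.1 = t then 1 else 0) + (if g.1.val.2 = t then 1 else 0) := by
  have hlt := g.1.2
  unfold HasInput ind
  by_cases h1 : g.1.val.1 = t <;> by_cases h2 : g.1.val.2 = t
  · rw [h1, h2] at hlt; exact absurd hlt (lt_irrefl _)
  all_goals simp [h1, h2]

theorem gateMean_hasInput (ha : IsSymmetricDistribution a) (hn : 2 ≤ n) (t : Fin n) :
    gateMean a (fun g => ind (HasInput g t)) = 2 / n := by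
  have h : ∀ f : BoolFun, ∑ p : InputPair n, ind (HasInput (p, f) t) = n - 1 := by
    intro f
    simp_rw [ind_hasInput]
    rw [sum_inputPair_mem t (fun _ => 1) (fun _ => 1)]
    simp only [Finset.sum_const, nsmul_eq_mul, mul_one, card_fin_lt, card_fin_gt]
    rw [← Nat.cast_add, Nat.sub_add_cancel (by have := t.2; omega), Nat.cast_sub (by omega)]
    simp
  rw [gateMean_eq]
  simp_rw [h]
  rw [← Finset.sum_mul, ha.sum_eq_one, choose_two_eq]
  have h2 : (2 : ℝ) ≤ n := by exact_mod_cast hn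
  have : (n : ℝ) - 1 ≠ 0 := by linarith
  have : (n : ℝ) ≠ 0 := by linarith
  field_simp

theorem gateMean_hasInput_mem_le (ha : IsSymmetricDistribution a) (hn : 2 ≤ n)
    (T : Finset (Fin n)) :
    gateMean a (fun g => ind (∃ t ∈ T, HasInput g t)) ≤ T.card * (2 / n) := by
  calc _ ≤ gateMean a (fun g => ∑ t ∈ T, ind (HasInput g t)) :=
        gateMean_mono ha fun g => ind_exists_le_sum _ _
    _ = T.card * (2 / n) := by
        rw [gateMean_sum]; simp [gateMean_hasInput ha hn]

/-- Only one pair of inputs qualifies. This supplies the additional factor of order 1/n that rules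
out bicycles. -/
theorem gateMean_inputs_le (ha : IsSymmetricDistribution a) {s t : Fin n}
    (hst : s ≠ t) :
    gateMean a (fun g => ind (HasInput g s ∧ HasInput g t)) ≤ 2 / (n * (n - 1)) := by
  rw [gateMean_eq]
  have h : ∀ f : BoolFun, ∑ p : InputPair n, ind (HasInput (p, f) s ∧ HasInput (p, f) t) ≤ 1 := by
    intro f
    have hle : ∀ p : InputPair n, ind (HasInput (p, f) s ∧ HasInput (p, f) t)
        ≤ if p.val = (min s t, max s t) then 1 else 0 := by
      intro p
      by_cases hp : HasInput (p, f) s ∧ HasInput (p, f) t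
      · rw [ind_true hp, if_pos]
        have hlt := p.2
        obtain ⟨h1 | h1, h2 | h2⟩ := hp
        · exact absurd (h1.symm.trans h2) hst
        · simp only at h1 h2
          rw [h1, h2] at hlt
          rw [min_eq_left hlt.le, max_eq_right hlt.le, ← h1, ← h2]
        · simp only at h1 h2
          rw [h1, h2] at hlt
          rw [min_eq_right hlt.le, max_eq_left hlt.le, ← h1, ← h2]
        · exact absurd (h1.symm.trans h2) hst
      · rw [ind_false hp]; split_ifs <;> norm_num
    refine (Finset.sum_le_sum fun p _ => hle p).trans ?_
    rw [Finset.sum_boole]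
    norm_cast
    rw [Finset.card_le_one]
    intro p hp q hq
    simp only [Finset.mem_filter, Finset.mem_univ, true_and] at hp hq
    exact Subtype.ext (hp.trans hq.symm)
  calc _ ≤ ∑ f, a f * ((n.choose 2 : ℝ)⁻¹ * 1) := by
        refine Finset.sum_le_sum fun f _ => mul_le_mul_of_nonneg_left
          (mul_le_mul_of_nonneg_left (h f) (by positivity)) (ha.nonneg f)
    _ = 2 / (n * (n - 1)) := by
        rw [← Finset.sum_mul, ha.sum_eq_one, choose_two_eq]
        simp

/-- Markov's inequality for 2 to the power of the outdegree, whose mean (1 + 2/n)^n is at most e²,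
followed by a union bound over the gates. -/
theorem pr_not_smallOutdegree_le (ha : IsSymmetricDistribution a) (hn : 2 ≤ n) (D : ℕ) :
    pr a n (fun B => ¬ SmallOutdegree D B) ≤ n * Real.exp 2 / 2 ^ D := by
  have hterm : ∀ t : Fin n, pr a n (fun B => D < outdeg B ∅ t) ≤ Real.exp 2 / 2 ^ D := by
    intro t
    have hpow : ∀ B : Automaton n, (2 : ℝ) ^ outdeg B ∅ t
        = ∏ i, (1 + ind (HasInput (B i) t)) := by
      intro B
      have : ∀ i, 1 + ind (HasInput (B i) t) = if HasInput (B i) t then 2 else 1 := by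
        intro i; unfold ind; split_ifs <;> norm_num
      simp_rw [this]
      rw [Finset.prod_ite]
      simp [outdeg]
    rw [pr_eq]
    calc expect a (fun B => ind (D < outdeg B ∅ t))
        ≤ expect a (fun B => (∏ i, (1 + ind (HasInput (B i) t))) * (1 / 2 ^ D)) := by
          refine expect_mono ha fun B => ?_
          rw [← hpow]
          by_cases h : D < outdeg B ∅ t
          · rw [ind_true h, mul_one_div, le_div_iff₀ (by positivity), one_mul]
            exact pow_le_pow_right₀ (by norm_num) h.le
          · rw [ind_false h]; positivity
      _ = (1 + 2 / n) ^ n * (1 / 2 ^ D) := by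
          rw [expect_mul_right, expect_prod (fun _ g => 1 + ind (HasInput g t))]
          simp only [gateMean_add, gateMean_const ha hn, gateMean_hasInput ha hn]
          simp
      _ ≤ Real.exp 2 * (1 / 2 ^ D) := by
          refine mul_le_mul_of_nonneg_right ?_ (by positivity)
          have h0 : (n : ℝ) ≠ 0 := by positivity
          calc (1 + 2 / (n : ℝ)) ^ n ≤ (Real.exp (2 / n)) ^ n := by
                refine pow_le_pow_left₀ (by positivity) ?_ _
                rw [add_comm]; exact Real.add_one_le_exp _
            _ = Real.exp 2 := by
                rw [← Real.exp_nat_mul]; congr 1; field_simp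
      _ = Real.exp 2 / 2 ^ D := by ring
  calc _ ≤ pr a n (fun B => ∃ t ∈ Finset.univ, D < outdeg B ∅ t) := by
        refine pr_mono ha fun B h => ?_
        simpa [SmallOutdegree] using h
    _ ≤ ∑ t : Fin n, pr a n (fun B => D < outdeg B ∅ t) := pr_exists_le_sum ha _ _
    _ ≤ ∑ t : Fin n, Real.exp 2 / 2 ^ D := Finset.sum_le_sum fun t _ => hterm t
    _ = n * Real.exp 2 / 2 ^ D := by simp; ring

/-! ### Balanced statuses and random pairs of inputs -/

/-- The number of gates below `u` that have the status `α`. -/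
noncomputable def cnt (s : Fin n → Option Bool) (u : ℕ) (α : Option Bool) : ℝ :=
  ∑ w : Fin n with w.val < u, ind (s w = α)

/-- Up to `ε * n`, every initial segment of the gates has the proportions `π` of statuses. -/
def Balanced (s : Fin n → Option Bool) (π : Option Bool → ℝ) (ε : ℝ) : Prop :=
  ∀ u ≤ n, ∀ α, |cnt s u α - π α * u| ≤ ε * n

/-- Changing the statuses of few gates preserves balance. -/
theorem Balanced.of_eq_off {s s' : Fin n → Option Bool} {π : Option Bool → ℝ} {ε δ : ℝ}
    (h : Balanced s π ε) (T : Finset (Fin n)) (hT : ∀ i ∉ T, s' i = s i)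
    (hcard : (T.card : ℝ) ≤ δ * n) : Balanced s' π (ε + δ) := by
  intro u hu α
  have hdiff : |cnt s' u α - cnt s u α| ≤ T.card := by
    unfold cnt
    rw [← Finset.sum_sub_distrib]
    calc _ ≤ ∑ w : Fin n with w.val < u, |ind (s' w = α) - ind (s w = α)| :=
          Finset.abs_sum_le_sum_abs _ _
      _ ≤ ∑ w : Fin n, |ind (s' w = α) - ind (s w = α)| :=
          Finset.sum_le_sum_of_subset_of_nonneg (Finset.filter_subset _ _)
            fun _ _ _ => abs_nonneg _
      _ ≤ ∑ w : Fin n, if w ∈ T then 1 else 0 := by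
          refine Finset.sum_le_sum fun w _ => ?_
          split_ifs with hw
          · have h1 := ind_nonneg (s' w = α)
            have h2 := ind_nonneg (s w = α)
            have h3 := ind_le_one (s' w = α)
            have h4 := ind_le_one (s w = α)
            rw [abs_le]; constructor <;> linarith
          · rw [hT w hw]; simp
      _ = T.card := by simp
  have h1 := h u hu α
  calc |cnt s' u α - π α * u| = |(cnt s' u α - cnt s u α) + (cnt s u α - π α * u)| := by ring_nf
    _ ≤ T.card + ε * n := (abs_add_le _ _).trans (add_le_add hdiff h1)
    _ ≤ (ε + δ) * n := by linarith

theorem sum_lt_comp_status (s : Fin n → Option Bool) (H : Option Bool → ℝ) (u : ℕ) :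
    ∑ w : Fin n with w.val < u, H (s w) = ∑ α, H α * cnt s u α := by
  unfold cnt
  simp_rw [Finset.mul_sum]
  rw [Finset.sum_comm]
  refine Finset.sum_congr rfl fun w _ => ?_
  rw [Finset.sum_eq_single (s w)]
  · simp
  · intro α _ hα; rw [ind_false (Ne.symm hα), mul_zero]
  · simp

theorem sum_gt_eq_sub (F : Fin n → ℝ) (j : Fin n) :
    ∑ k with j < k, F k = ∑ w : Fin n with w.val < n, F w
      - ∑ w : Fin n with w.val < j.val + 1, F w := by
  rw [eq_sub_iff_add_eq, Finset.sum_filter, Finset.sum_filter, Finset.sum_filter,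
    ← Finset.sum_add_distrib]
  refine Finset.sum_congr rfl fun k _ => ?_
  have := k.2
  by_cases h : j < k
  · have h' : ¬ k.val < j.val + 1 := by rw [Fin.lt_def] at h; omega
    simp [h, h']
  · have h' : k.val < j.val + 1 := by rw [Fin.lt_def] at h; omega
    simp [h, h']

theorem sum_lt_eq_sum_gt (F : Fin n → Fin n → ℝ) :
    ∑ k : Fin n, ∑ j with j < k, F j k = ∑ j : Fin n, ∑ k with j < k, F j k := by
  simp_rw [Finset.sum_filter]
  exact Finset.sum_comm

/-- The number of pairs of inputs with statuses `α` and `β`. -/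
noncomputable def pairCount (s : Fin n → Option Bool) (α β : Option Bool) : ℝ :=
  ∑ p : InputPair n, ind (s p.val.1 = α) * ind (s p.val.2 = β)

/-- Balance on the segment below `k` handles the smaller input, at a cost of εn². After exchanging
the sums, the larger input runs over a final segment, a difference of two initial ones, which costs
2εn². -/
theorem Balanced.pairCount_sub_le {s : Fin n → Option Bool} {π : Option Bool → ℝ} {ε : ℝ}
    (h : Balanced s π ε) (hπ0 : ∀ α, 0 ≤ π α) (hπ1 : ∀ α, π α ≤ 1) (α β : Option Bool) :
    |pairCount s α β - π α * π β * n.choose 2| ≤ 3 * ε * n ^ 2 := by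
  have e1 : pairCount s α β = ∑ k : Fin n, ind (s k = β) * cnt s k α := by
    unfold pairCount cnt
    rw [sum_inputPair (fun j k => ind (s j = α) * ind (s k = β))]
    refine Finset.sum_congr rfl fun k _ => ?_
    rw [Finset.mul_sum]
    exact Finset.sum_congr rfl fun j _ => mul_comm _ _
  have e2 : ∑ k : Fin n, ind (s k = β) * (k.val : ℝ)
      = ∑ j : Fin n, (cnt s n β - cnt s (j.val + 1) β) := by
    have : ∀ k : Fin n, ind (s k = β) * (k.val : ℝ) = ∑ j with j < k, ind (s k = β) := by
      intro k; rw [Finset.sum_const, card_fin_lt, nsmul_eq_mul, mul_comm]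
    simp_rw [this]
    rw [sum_lt_eq_sum_gt (fun _ k => ind (s k = β))]
    exact Finset.sum_congr rfl fun j _ => sum_gt_eq_sub _ j
  have e3 : (n.choose 2 : ℝ) = ∑ j : Fin n, ((n : ℝ) - (j.val + 1 : ℕ)) := by
    rw [← card_inputPair, ← Finset.card_univ, Finset.card_eq_sum_ones, Nat.cast_sum]
    rw [sum_inputPair (fun _ _ => ((1 : ℕ) : ℝ)), sum_lt_eq_sum_gt]
    refine Finset.sum_congr rfl fun j _ => ?_
    rw [Finset.sum_const, card_fin_gt, nsmul_eq_mul]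
    have := j.2
    rw [Nat.sub_sub, Nat.cast_sub (by omega)]
    push_cast; ring
  have b1 : |∑ k : Fin n, ind (s k = β) * (cnt s k α - π α * k.val)| ≤ ε * n * n := by
    calc _ ≤ ∑ k : Fin n, |ind (s k = β) * (cnt s k α - π α * k.val)| :=
          Finset.abs_sum_le_sum_abs _ _
      _ ≤ ∑ k : Fin n, ε * n := by
          refine Finset.sum_le_sum fun k _ => ?_
          rw [abs_mul, abs_of_nonneg (ind_nonneg _)]
          exact (mul_le_of_le_one_left (abs_nonneg _) (ind_le_one _)).trans (h k k.2.le α)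
      _ = ε * n * n := by simp; ring
  have b2 : |∑ j : Fin n, ((cnt s n β - cnt s (j.val + 1) β)
      - π β * ((n : ℝ) - (j.val + 1 : ℕ)))| ≤ 2 * ε * n * n := by
    calc _ ≤ ∑ j : Fin n, |(cnt s n β - cnt s (j.val + 1) β)
          - π β * ((n : ℝ) - (j.val + 1 : ℕ))| := Finset.abs_sum_le_sum_abs _ _
      _ ≤ ∑ j : Fin n, 2 * ε * n := by
          refine Finset.sum_le_sum fun j _ => ?_
          have h1 := h n le_rfl β
          have h2 := h (j.val + 1) j.2 β
          rw [abs_le] at h1 h2 ⊢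
          constructor <;> nlinarith [h1.1, h1.2, h2.1, h2.2]
      _ = 2 * ε * n * n := by simp; ring
  have e4 : pairCount s α β - π α * π β * n.choose 2
      = ∑ k : Fin n, ind (s k = β) * (cnt s k α - π α * k.val)
        + π α * ∑ j : Fin n, ((cnt s n β - cnt s (j.val + 1) β)
          - π β * ((n : ℝ) - (j.val + 1 : ℕ))) := by
    rw [Finset.sum_sub_distrib, ← e2, ← Finset.mul_sum, ← e3, e1]
    simp_rw [mul_sub]
    rw [Finset.sum_sub_distrib, Finset.mul_sum]
    have : ∀ k : Fin n, ind (s k = β) * (π α * (k.val : ℝ))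
        = π α * (ind (s k = β) * (k.val : ℝ)) := fun k => by ring
    simp_rw [this]
    ring
  rw [e4]
  refine (abs_add_le _ _).trans ?_
  rw [abs_mul, abs_of_nonneg (hπ0 α)]
  have := mul_le_of_le_one_left (abs_nonneg _) (hπ1 α) |>.trans b2
  nlinarith [this, b1]

/-- The mean of `h` over the statuses of a random pair of inputs. -/
noncomputable def pairMean (s : Fin n → Option Bool) (h : Option Bool → Option Bool → ℝ) : ℝ :=
  (n.choose 2 : ℝ)⁻¹ * ∑ p : InputPair n, h (s p.val.1) (s p.val.2)

theorem pairMean_eq (s : Fin n → Option Bool) (h : Option Bool → Option Bool → ℝ) :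
    pairMean s h = (n.choose 2 : ℝ)⁻¹ * ∑ α, ∑ β, h α β * pairCount s α β := by
  unfold pairMean pairCount
  congr 1
  simp_rw [Finset.mul_sum]
  have : ∀ α : Option Bool, ∑ β : Option Bool, ∑ p : InputPair n,
      h α β * (ind (s p.val.1 = α) * ind (s p.val.2 = β))
      = ∑ p : InputPair n, h α (s p.val.2) * ind (s p.val.1 = α) := by
    intro α
    rw [Finset.sum_comm]
    refine Finset.sum_congr rfl fun p _ => ?_
    rw [Finset.sum_eq_single (s p.val.2)]
    · simp
    · intro β _ hβ; rw [ind_false (Ne.symm hβ), mul_zero, mul_zero]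
    · simp
  simp_rw [this]
  rw [Finset.sum_comm]
  refine Finset.sum_congr rfl fun p _ => ?_
  rw [Finset.sum_eq_single (s p.val.1)]
  · simp
  · intro β _ hβ; rw [ind_false (Ne.symm hβ), mul_zero]
  · simp

theorem sq_le_four_mul_choose_two (hn : 2 ≤ n) : (n : ℝ) ^ 2 ≤ 4 * n.choose 2 := by
  rw [choose_two_eq]
  have : (2 : ℝ) ≤ n := by exact_mod_cast hn
  nlinarith

theorem Balanced.pairMean_sub_le {s : Fin n → Option Bool} {π : Option Bool → ℝ} {ε : ℝ}
    (hn : 2 ≤ n) (hs : Balanced s π ε) (hε : 0 ≤ ε) (hπ0 : ∀ α, 0 ≤ π α) (hπ1 : ∀ α, π α ≤ 1)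
    {h : Option Bool → Option Bool → ℝ} (hh : ∀ α β, |h α β| ≤ 1) :
    |pairMean s h - ∑ α, ∑ β, π α * π β * h α β| ≤ 108 * ε := by
  have hC := choose_two_pos hn
  have e : pairMean s h - ∑ α, ∑ β, π α * π β * h α β
      = (n.choose 2 : ℝ)⁻¹ * ∑ α, ∑ β, h α β * (pairCount s α β - π α * π β * n.choose 2) := by
    rw [pairMean_eq]
    simp_rw [mul_sub, Finset.sum_sub_distrib]
    rw [mul_sub]
    congr 1
    rw [Finset.mul_sum]
    refine Finset.sum_congr rfl fun α _ => ?_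
    rw [Finset.mul_sum]
    refine Finset.sum_congr rfl fun β _ => ?_
    field_simp
  have b : |∑ α, ∑ β, h α β * (pairCount s α β - π α * π β * n.choose 2)|
      ≤ ∑ α : Option Bool, ∑ β : Option Bool, 3 * ε * n ^ 2 := by
    refine (Finset.abs_sum_le_sum_abs _ _).trans (Finset.sum_le_sum fun α _ => ?_)
    refine (Finset.abs_sum_le_sum_abs _ _).trans (Finset.sum_le_sum fun β _ => ?_)
    rw [abs_mul]
    exact (mul_le_of_le_one_left (abs_nonneg _) (hh α β)).trans
      (hs.pairCount_sub_le hπ0 hπ1 α β)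
  simp only [Finset.sum_const, Finset.card_univ, Fintype.card_option, Fintype.card_bool,
    nsmul_eq_mul] at b
  rw [e, abs_mul, abs_of_pos (inv_pos.mpr hC), inv_mul_le_iff₀ hC]
  -- Nine pairs of statuses contribute 27εn² in all, and n² is at most four times the number of
  -- pairs of inputs; hence 108.
  refine b.trans ?_
  have := sq_le_four_mul_choose_two hn
  push_cast
  nlinarith

/-- The probability that a random gate gets the status `α` when its inputs have the
statuses `s`. -/
noncomputable def statusProb (a : BoolFun → ℝ) (s : Fin n → Option Bool) (α : Option Bool) : ℝ :=
  gateMean a (fun g => ind (force g.2 (s g.1.val.1) (s g.1.val.2) = α))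

/-- The distribution of the status of a gate whose inputs have independent statuses with the
distribution `π`. -/
noncomputable def nextStatus (a : BoolFun → ℝ) (π : Option Bool → ℝ) (α : Option Bool) : ℝ :=
  ∑ f, a f * ∑ β, ∑ γ, π β * π γ * ind (force f β γ = α)

theorem Balanced.statusProb_sub_le (ha : IsSymmetricDistribution a) {s : Fin n → Option Bool}
    {π : Option Bool → ℝ} {ε : ℝ} (hn : 2 ≤ n) (hs : Balanced s π ε) (hε : 0 ≤ ε)
    (hπ0 : ∀ α, 0 ≤ π α) (hπ1 : ∀ α, π α ≤ 1) (α : Option Bool) :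
    |statusProb a s α - nextStatus a π α| ≤ 108 * ε := by
  have e : statusProb a s α - nextStatus a π α
      = ∑ f, a f * (pairMean s (fun β γ => ind (force f β γ = α))
        - ∑ β, ∑ γ, π β * π γ * ind (force f β γ = α)) := by
    unfold statusProb nextStatus
    rw [gateMean_eq]
    simp_rw [mul_sub]
    rw [Finset.sum_sub_distrib]
    rfl
  rw [e]
  calc _ ≤ ∑ f, a f * (108 * ε) := by
        refine (Finset.abs_sum_le_sum_abs _ _).trans (Finset.sum_le_sum fun f _ => ?_)
        rw [abs_mul, abs_of_nonneg (ha.nonneg f)]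
        refine mul_le_mul_of_nonneg_left (hs.pairMean_sub_le hn hε hπ0 hπ1 fun β γ => ?_)
          (ha.nonneg f)
        rw [abs_of_nonneg (ind_nonneg _)]
        exact ind_le_one _
    _ = 108 * ε := by rw [← Finset.sum_mul, ha.sum_eq_one, one_mul]

/-! ### Live inputs -/

/-- The value of `f` may depend on its first argument if its second one has the status `β`. -/
def LiveFst (f : BoolFun) (β : Option Bool) : Prop := ∃ y, Compat β y ∧ f false y ≠ f true y

/-- The value of `f` may depend on its second argument if its first one has the status `β`. -/
def LiveSnd (f : BoolFun) (β : Option Bool) : Prop := ∃ x, Compat β x ∧ f x false ≠ f x true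

instance (f : BoolFun) (β : Option Bool) : Decidable (LiveFst f β) := by
  unfold LiveFst; infer_instance

instance (f : BoolFun) (β : Option Bool) : Decidable (LiveSnd f β) := by
  unfold LiveSnd; infer_instance

/-- The gate `t` is an input that may matter, given the statuses `s`. -/
def LiveInput (s : Fin n → Option Bool) (g : Gate n) (t : Fin n) : Prop :=
  (g.1.val.1 = t ∧ LiveFst g.2 (s g.1.val.2)) ∨ (g.1.val.2 = t ∧ LiveSnd g.2 (s g.1.val.1))

theorem LiveInput.hasInput {s : Fin n → Option Bool} {g : Gate n} {t : Fin n}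
    (h : LiveInput s g t) : HasInput g t := h.imp And.left And.left

theorem LiveInput.leave_out {B : Automaton n} (R : Finset (Fin n)) {τ : ℕ} {g : Gate n}
    {t : Fin n} (h : LiveInput (status B ∅ τ) g t) : LiveInput (status B R τ) g t := by
  rcases h with ⟨h1, y, hy, h2⟩ | ⟨h1, y, hy, h2⟩
  · exact Or.inl ⟨h1, y, hy.leave_out R, h2⟩
  · exact Or.inr ⟨h1, y, hy.leave_out R, h2⟩

theorem Balanced.sum_lt_sub_le {s : Fin n → Option Bool} {π : Option Bool → ℝ} {ε : ℝ}
    (hs : Balanced s π ε) {H : Option Bool → ℝ} (hH0 : ∀ β, 0 ≤ H β) (hH1 : ∀ β, H β ≤ 1)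
    {u : ℕ} (hu : u ≤ n) :
    |∑ w : Fin n with w.val < u, H (s w) - u * ∑ β, π β * H β| ≤ 3 * ε * n := by
  rw [sum_lt_comp_status]
  have e : ∑ α, H α * cnt s u α - u * ∑ β, π β * H β = ∑ α, H α * (cnt s u α - π α * u) := by
    rw [Finset.mul_sum, ← Finset.sum_sub_distrib]
    exact Finset.sum_congr rfl fun α _ => by ring
  rw [e]
  calc _ ≤ ∑ α : Option Bool, ε * n := by
        refine (Finset.abs_sum_le_sum_abs _ _).trans (Finset.sum_le_sum fun α _ => ?_)
        rw [abs_mul, abs_of_nonneg (hH0 α)]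
        exact (mul_le_of_le_one_left (abs_nonneg _) (hH1 α)).trans (hs u hu α)
    _ = 3 * ε * n := by simp; ring

/-- The gate `t` is the first input in n - 1 - t pairs and the second one in t pairs. Because both
arguments have the same bound Λ/2, the total does not depend on t. -/
theorem Balanced.gateMean_liveInput_le (ha : IsSymmetricDistribution a)
    {s : Fin n → Option Bool} {π : Option Bool → ℝ} {ε Λ : ℝ} (hn : 2 ≤ n)
    (hs : Balanced s π ε) (hε : 0 ≤ ε)
    (h1 : ∑ β, π β * ∑ f, a f * ind (LiveFst f β) ≤ Λ / 2)
    (h2 : ∑ β, π β * ∑ f, a f * ind (LiveSnd f β) ≤ Λ / 2) (t : Fin n) :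
    gateMean a (fun g => ind (LiveInput s g t)) ≤ (Λ + 36 * ε) / n := by
  have hC := choose_two_pos hn
  set H₁ : Option Bool → ℝ := fun β => ∑ f, a f * ind (LiveFst f β)
  set H₂ : Option Bool → ℝ := fun β => ∑ f, a f * ind (LiveSnd f β)
  have hH : ∀ P : BoolFun → Prop, 0 ≤ ∑ f, a f * ind (P f) ∧ ∑ f, a f * ind (P f) ≤ 1 := by
    intro P
    refine ⟨Finset.sum_nonneg fun f _ => mul_nonneg (ha.nonneg f) (ind_nonneg _), ?_⟩
    rw [← ha.sum_eq_one]
    exact Finset.sum_le_sum fun f _ => mul_le_of_le_one_right (ha.nonneg f) (ind_le_one _)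
  have hle : ∀ f : BoolFun, ∑ p : InputPair n, ind (LiveInput s (p, f) t)
      ≤ ∑ k with t < k, ind (LiveFst f (s k)) + ∑ j with j < t, ind (LiveSnd f (s j)) := by
    intro f
    rw [← sum_inputPair_mem t (fun k => ind (LiveFst f (s k))) (fun j => ind (LiveSnd f (s j)))]
    refine Finset.sum_le_sum fun p _ => (ind_or_le _ _).trans (add_le_add ?_ ?_)
    · rw [ind_and]
      split_ifs with h <;> simp [h]
    · rw [ind_and]
      split_ifs with h <;> simp [h]
  have key : gateMean a (fun g => ind (LiveInput s g t))
      ≤ (n.choose 2 : ℝ)⁻¹ * (∑ k with t < k, H₁ (s k) + ∑ j with j < t, H₂ (s j)) := by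
    rw [gateMean_eq]
    calc _ ≤ ∑ f, a f * ((n.choose 2 : ℝ)⁻¹ * (∑ k with t < k, ind (LiveFst f (s k))
          + ∑ j with j < t, ind (LiveSnd f (s j)))) := by
          refine Finset.sum_le_sum fun f _ => mul_le_mul_of_nonneg_left
            (mul_le_mul_of_nonneg_left (hle f) (by positivity)) (ha.nonneg f)
      _ = _ := by
          simp only [H₁, H₂]
          rw [Finset.sum_comm, Finset.sum_comm (s := Finset.univ.filter (· < t)),
            ← Finset.sum_add_distrib, Finset.mul_sum]
          refine Finset.sum_congr rfl fun f _ => ?_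
          rw [← Finset.mul_sum, ← Finset.mul_sum]
          ring
  have b1 := hs.sum_lt_sub_le (H := H₁) (fun β => (hH _).1) (fun β => (hH _).2) le_rfl
  have b2 := hs.sum_lt_sub_le (H := H₁) (fun β => (hH _).1) (fun β => (hH _).2)
    (u := t.val + 1) t.2
  have b3 := hs.sum_lt_sub_le (H := H₂) (fun β => (hH _).1) (fun β => (hH _).2) t.2.le
  rw [abs_le] at b1 b2 b3
  have e3 : ∑ j with j < t, H₂ (s j) = ∑ j : Fin n with j.val < t.val, H₂ (s j) := rfl
  have htn : ((t.val + 1 : ℕ) : ℝ) ≤ n := by exact_mod_cast t.2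
  have h2n : (2 : ℝ) ≤ n := by exact_mod_cast hn
  have ht0 : (0 : ℝ) ≤ t.val := by positivity
  push_cast at b2 htn
  -- Three segment estimates with error 3εn each. Division by n(n - 1)/2 turns 9εn into at most
  -- 36ε/n, as n ≤ 2(n - 1).
  have hsum : ∑ k with t < k, H₁ (s k) + ∑ j with j < t, H₂ (s j)
      ≤ (n - 1) * (Λ / 2) + 9 * ε * n := by
    rw [sum_gt_eq_sub (fun k => H₁ (s k)), e3]
    have c1 := mul_le_mul_of_nonneg_left h1 (show (0 : ℝ) ≤ n - 1 - t.val by linarith)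
    have c2 := mul_le_mul_of_nonneg_left h2 ht0
    nlinarith [b1.1, b1.2, b2.1, b2.2, b3.1, b3.2]
  refine key.trans ?_
  rw [inv_mul_le_iff₀ hC]
  refine hsum.trans ?_
  have hn0 : (n : ℝ) ≠ 0 := by linarith
  have e : (n : ℝ) * (n - 1) / 2 * ((Λ + 36 * ε) / n) = (n - 1) / 2 * (Λ + 36 * ε) := by
    field_simp
  rw [choose_two_eq, e]
  nlinarith

/-! ### Sensitivity and the recursion for the proportions of statuses -/

/-- The mean number of arguments to which a random function is sensitive at a random point. -/
noncomputable def sensitivity (a : BoolFun → ℝ) : ℝ :=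
  1 - ∑ f ∈ classA, a f + ∑ f ∈ classC, a f

/-- The sign of a status. -/
def statusSign : Option Bool → ℤ
  | none => 0
  | some true => 1
  | some false => -1

theorem statusSign_eq (β : Option Bool) :
    (statusSign β : ℝ) = ind (β = some true) - ind (β = some false) := by
  rcases β with _ | _ | _ <;> simp [statusSign, ind]

/-- Negation of a boolean function. -/
def negFun (f : BoolFun) : BoolFun := fun x y => !(f x y)

/-- Exchange of the arguments of a boolean function. -/
def swapFun (f : BoolFun) : BoolFun := fun x y => f y x

theorem negFun_involutive : Function.Involutive negFun := fun f => by
  funext x y; simp [negFun]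

theorem swapFun_involutive : Function.Involutive swapFun := fun _ => rfl

theorem statusSign_force_negFun : ∀ (f : BoolFun) (β γ : Option Bool),
    statusSign (force (negFun f) β γ) = - statusSign (force f β γ) := by decide

/-- The cases are grouped by the number of known inputs: if the two values are equally likely, the
cases of one group have the same weight. -/
theorem statusSign_force_sums : ∀ f : BoolFun, f ∉ classA ∪ classB₂ →
    statusSign (force f none none) = 0 ∧
    statusSign (force f none (some true)) + statusSign (force f none (some false))
      + statusSign (force f (some true) none) + statusSign (force f (some false) none) = 0 ∧
    statusSign (force f (some true) (some true)) + statusSign (force f (some true) (some false))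
      + statusSign (force f (some false) (some true))
      + statusSign (force f (some false) (some false)) = 0 := by
  decide

/-- With exactly one input known, there are four cases. The result stays unknown in none of them for
a constant function, in two for any other canalyzing function, and in all four for a non-canalyzing
one. -/
theorem force_none_counts : ∀ f : BoolFun,
    ((if force f none none = none then 1 else 0 : ℤ) = 1 - (if f ∈ classA then 1 else 0)) ∧
    ((if force f none (some true) = none then 1 else 0 : ℤ)
      + (if force f none (some false) = none then 1 else 0)
      + (if force f (some true) none = none then 1 else 0)
      + (if force f (some false) none = none then 1 else 0)
      = 2 - 2 * (if f ∈ classA then 1 else 0) + 2 * (if f ∈ classC then 1 else 0)) ∧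
    ∀ b c, force f (some b) (some c) ≠ none := by
  decide

theorem live_counts : ∀ f : BoolFun,
    ((if LiveFst f (some true) then 1 else 0 : ℤ) + (if LiveFst f (some false) then 1 else 0)
      + (if LiveSnd f (some true) then 1 else 0) + (if LiveSnd f (some false) then 1 else 0)
      = 2 - 2 * (if f ∈ classA then 1 else 0) + 2 * (if f ∈ classC then 1 else 0)) := by
  decide

/-- Only functions of a single argument distinguish the two arguments on average, which is why the
swap symmetry is needed on ℬ₁ alone. -/
theorem live_eq_of_notMem : ∀ f : BoolFun, f ∉ classB₁ →
    ((if LiveFst f (some true) then 1 else 0 : ℤ) + (if LiveFst f (some false) then 1 else 0)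
      = (if LiveSnd f (some true) then 1 else 0) + (if LiveSnd f (some false) then 1 else 0)) := by
  decide

theorem ind_eq_ite (p : Prop) [Decidable p] : ind p = ((if p then 1 else 0 : ℤ) : ℝ) := by
  unfold ind; split_ifs <;> simp

theorem sum_mul_counts (a : BoolFun → ℝ) (ha : IsSymmetricDistribution a) :
    ∑ f, a f * (2 - 2 * (if f ∈ classA then 1 else 0) + 2 * (if f ∈ classC then 1 else 0))
      = 2 * sensitivity a := by
  unfold sensitivity
  have hA : ∑ f, a f * (if f ∈ classA then (1 : ℝ) else 0) = ∑ f ∈ classA, a f := by simp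
  have hC : ∑ f, a f * (if f ∈ classC then (1 : ℝ) else 0) = ∑ f ∈ classC, a f := by simp
  calc _ = 2 * ∑ f, a f - 2 * ∑ f, a f * (if f ∈ classA then (1 : ℝ) else 0)
        + 2 * ∑ f, a f * (if f ∈ classC then (1 : ℝ) else 0) := by
        rw [Finset.mul_sum, Finset.mul_sum, Finset.mul_sum, ← Finset.sum_sub_distrib,
          ← Finset.sum_add_distrib]
        exact Finset.sum_congr rfl fun f _ => by ring
    _ = _ := by rw [hA, hC, ha.sum_eq_one]; ring

theorem nextStatus_nonneg (ha : IsSymmetricDistribution a) {π : Option Bool → ℝ}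
    (hπ : ∀ α, 0 ≤ π α) (α : Option Bool) : 0 ≤ nextStatus a π α :=
  Finset.sum_nonneg fun f _ => mul_nonneg (ha.nonneg f) <|
    Finset.sum_nonneg fun β _ => Finset.sum_nonneg fun γ _ =>
      mul_nonneg (mul_nonneg (hπ β) (hπ γ)) (ind_nonneg _)

theorem sum_nextStatus (ha : IsSymmetricDistribution a) {π : Option Bool → ℝ}
    (hπ : ∑ α, π α = 1) : ∑ α, nextStatus a π α = 1 := by
  unfold nextStatus
  rw [Finset.sum_comm]
  have h : ∀ f : BoolFun, ∑ α, a f * ∑ β, ∑ γ, π β * π γ * ind (force f β γ = α) = a f := by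
    intro f
    rw [← Finset.mul_sum, Finset.sum_comm]
    have : ∀ β, ∑ α, ∑ γ, π β * π γ * ind (force f β γ = α) = π β := by
      intro β
      rw [Finset.sum_comm]
      have : ∀ γ, ∑ α, π β * π γ * ind (force f β γ = α) = π β * π γ := by
        intro γ
        rw [Finset.sum_eq_single (force f β γ)]
        · simp
        · intro α _ h; rw [ind_false (Ne.symm h), mul_zero]
        · simp
      simp_rw [this]
      rw [← Finset.mul_sum, hπ, mul_one]
    simp_rw [this]
    rw [hπ, mul_one]
  simp_rw [h]
  exact ha.sum_eq_one

/-- The symmetry conditions keep the two values equally likely. -/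
theorem nextStatus_symm (ha : IsSymmetricDistribution a) {π : Option Bool → ℝ}
    (hπ : π (some true) = π (some false)) :
    nextStatus a π (some true) = nextStatus a π (some false) := by
  set δ : BoolFun → ℝ := fun f => ∑ β, ∑ γ, π β * π γ * (statusSign (force f β γ) : ℝ)
  have hdiff : nextStatus a π (some true) - nextStatus a π (some false) = ∑ f, a f * δ f := by
    unfold nextStatus
    rw [← Finset.sum_sub_distrib]
    refine Finset.sum_congr rfl fun f _ => ?_
    rw [← mul_sub, ← Finset.sum_sub_distrib]
    congr 1
    refine Finset.sum_congr rfl fun β _ => ?_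
    rw [← Finset.sum_sub_distrib]
    refine Finset.sum_congr rfl fun γ _ => ?_
    rw [statusSign_eq, mul_sub]
  -- Functions outside 𝒜 ∪ ℬ₂ have no bias towards either value; the biases of the others cancel
  -- between a function and its negation.
  have hzero : ∀ f, f ∉ classA ∪ classB₂ → δ f = 0 := by
    intro f hf
    obtain ⟨h0, h1, h2⟩ := statusSign_force_sums f hf
    simp only [δ, Fintype.sum_option, Fintype.sum_bool, hπ]
    have h0' := congrArg (fun z : ℤ => (z : ℝ)) h0
    have h1' := congrArg (fun z : ℤ => (z : ℝ)) h1
    have h2' := congrArg (fun z : ℤ => (z : ℝ)) h2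
    push_cast at h0' h1' h2'
    linear_combination π none * π none * h0' + π none * π (some false) * h1'
      + π (some false) * π (some false) * h2'
  have hneg : ∀ f, δ (negFun f) = - δ f := by
    intro f
    simp only [δ, statusSign_force_negFun, Int.cast_neg, mul_neg, Finset.sum_neg_distrib]
  have hsum : ∑ f, a f * δ f = - ∑ f, a f * δ f := by
    rw [← Finset.sum_neg_distrib]
    refine Fintype.sum_equiv (Function.Involutive.toPerm negFun negFun_involutive) _ _ fun f => ?_
    change a f * δ f = -(a (negFun f) * δ (negFun f))
    rw [hneg]
    by_cases hf : f ∈ classA ∪ classB₂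
    · have : a (negFun f) = a f := (ha.neg_symm f hf).symm
      rw [this]; ring
    · rw [hzero f hf]; ring
  linarith

/-- Let u be the proportion of unknown gates. Two unknown inputs contribute u²(1 - a), exactly one
contributes u(1 - u)s, and two known ones contribute nothing. The bound follows from 1 - a ≤ s. -/
theorem nextStatus_none_le (ha : IsSymmetricDistribution a) {π : Option Bool → ℝ}
    (hπ1 : ∑ α, π α = 1) (hπ : π (some true) = π (some false)) :
    nextStatus a π none ≤ sensitivity a * π none := by
  have h1 : ∀ f : BoolFun, ∑ β, ∑ γ, π β * π γ * ind (force f β γ = none)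
      = π none ^ 2 * (1 - (if f ∈ classA then 1 else 0)) + π none * π (some false)
        * (2 - 2 * (if f ∈ classA then 1 else 0) + 2 * (if f ∈ classC then 1 else 0)) := by
    intro f
    obtain ⟨h0, h1, h2⟩ := force_none_counts f
    simp only [Fintype.sum_option, Fintype.sum_bool, hπ, ind_eq_ite, h2, if_false]
    have h0' := congrArg (fun z : ℤ => (z : ℝ)) h0
    have h1' := congrArg (fun z : ℤ => (z : ℝ)) h1
    push_cast at h0' h1' ⊢
    linear_combination π none * π none * h0' + π none * π (some false) * h1'
  have hA : ∑ f, a f * (1 - (if f ∈ classA then (1 : ℝ) else 0)) = 1 - ∑ f ∈ classA, a f := by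
    simp_rw [mul_sub, mul_one]
    rw [Finset.sum_sub_distrib, ha.sum_eq_one]
    simp
  have hnext : nextStatus a π none = π none ^ 2 * (1 - ∑ f ∈ classA, a f)
      + π none * π (some false) * (2 * sensitivity a) := by
    rw [← sum_mul_counts a ha, ← hA, Finset.mul_sum, Finset.mul_sum, ← Finset.sum_add_distrib]
    unfold nextStatus
    refine Finset.sum_congr rfl fun f _ => ?_
    rw [h1]; ring
  have hp : 2 * π (some false) = 1 - π none := by
    simp only [Fintype.sum_option, Fintype.sum_bool, hπ] at hπ1
    linarith
  have hc : 0 ≤ ∑ f ∈ classC, a f := Finset.sum_nonneg fun f _ => ha.nonneg f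
  have : 1 - ∑ f ∈ classA, a f ≤ sensitivity a := by unfold sensitivity; linarith
  have h3 := mul_le_mul_of_nonneg_left this (sq_nonneg (π none))
  rw [hnext]
  calc _ = π none ^ 2 * (1 - ∑ f ∈ classA, a f)
        + π none * sensitivity a * (2 * π (some false)) := by ring
    _ ≤ _ := by rw [hp]; nlinarith

/-- The limiting distribution of the status of a gate at time `τ`. -/
noncomputable def limitStatus (a : BoolFun → ℝ) : ℕ → Option Bool → ℝ
  | 0 => fun α => ind (α = none)
  | τ + 1 => nextStatus a (limitStatus a τ)

theorem limitStatus_nonneg (ha : IsSymmetricDistribution a) (τ : ℕ) (α : Option Bool) :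
    0 ≤ limitStatus a τ α := by
  induction τ generalizing α with
  | zero => exact ind_nonneg _
  | succ τ ih => exact nextStatus_nonneg ha ih α

theorem sum_limitStatus (ha : IsSymmetricDistribution a) (τ : ℕ) :
    ∑ α, limitStatus a τ α = 1 := by
  induction τ with
  | zero => simp [limitStatus, ind]
  | succ τ ih => exact sum_nextStatus ha ih

theorem limitStatus_le_one (ha : IsSymmetricDistribution a) (τ : ℕ) (α : Option Bool) :
    limitStatus a τ α ≤ 1 := by
  rw [← sum_limitStatus ha τ]
  exact Finset.single_le_sum (fun β _ => limitStatus_nonneg ha τ β) (Finset.mem_univ α)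

theorem limitStatus_symm (ha : IsSymmetricDistribution a) (τ : ℕ) :
    limitStatus a τ (some true) = limitStatus a τ (some false) := by
  induction τ with
  | zero => simp [limitStatus]
  | succ τ ih => exact nextStatus_symm ha ih

theorem sensitivity_nonneg (ha : IsSymmetricDistribution a) : 0 ≤ sensitivity a := by
  have h1 : ∑ f ∈ classA, a f ≤ 1 := by
    rw [← ha.sum_eq_one]
    exact Finset.sum_le_sum_of_subset_of_nonneg (Finset.subset_univ _) fun f _ _ => ha.nonneg f
  have h2 : 0 ≤ ∑ f ∈ classC, a f := Finset.sum_nonneg fun f _ => ha.nonneg f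
  unfold sensitivity; linarith

theorem limitStatus_none_le (ha : IsSymmetricDistribution a) (τ : ℕ) :
    limitStatus a τ none ≤ sensitivity a ^ τ := by
  induction τ with
  | zero => simp [limitStatus]
  | succ τ ih =>
    rw [pow_succ']
    exact (nextStatus_none_le ha (sum_limitStatus ha τ)
      (limitStatus_symm ha τ)).trans (mul_le_mul_of_nonneg_left ih (sensitivity_nonneg ha))

/-- The two sums add up to 2s by counting, and the swap symmetry makes them equal. -/
theorem sum_live_eq (ha : IsSymmetricDistribution a) :
    ∑ f, a f * (ind (LiveFst f (some true)) + ind (LiveFst f (some false))) = sensitivity a ∧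
    ∑ f, a f * (ind (LiveSnd f (some true)) + ind (LiveSnd f (some false))) = sensitivity a := by
  set l₁ : BoolFun → ℝ := fun f => ind (LiveFst f (some true)) + ind (LiveFst f (some false))
  set l₂ : BoolFun → ℝ := fun f => ind (LiveSnd f (some true)) + ind (LiveSnd f (some false))
  have hadd : ∑ f, a f * l₁ f + ∑ f, a f * l₂ f = 2 * sensitivity a := by
    rw [← sum_mul_counts a ha, ← Finset.sum_add_distrib]
    refine Finset.sum_congr rfl fun f _ => ?_
    have h := congrArg (fun z : ℤ => (z : ℝ)) (live_counts f)
    push_cast at h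
    simp only [l₁, l₂, ind_eq_ite]
    push_cast
    linear_combination a f * h
  have hsub : ∑ f, a f * (l₁ f - l₂ f) = - ∑ f, a f * (l₁ f - l₂ f) := by
    rw [← Finset.sum_neg_distrib]
    refine Fintype.sum_equiv (Function.Involutive.toPerm swapFun swapFun_involutive) _ _
      fun f => ?_
    change a f * (l₁ f - l₂ f) = -(a (swapFun f) * (l₁ (swapFun f) - l₂ (swapFun f)))
    have hs1 : l₁ (swapFun f) = l₂ f := rfl
    have hs2 : l₂ (swapFun f) = l₁ f := rfl
    rw [hs1, hs2]
    by_cases hf : f ∈ classB₁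
    · have : a (swapFun f) = a f := (ha.swap_symm f hf).symm
      rw [this]; ring
    · have h := congrArg (fun z : ℤ => (z : ℝ)) (live_eq_of_notMem f hf)
      push_cast at h
      have : l₁ f = l₂ f := by
        simp only [l₁, l₂, ind_eq_ite]
        push_cast
        exact h
      rw [this]; ring
  have hsub' : ∑ f, a f * (l₁ f - l₂ f) = ∑ f, a f * l₁ f - ∑ f, a f * l₂ f := by
    rw [← Finset.sum_sub_distrib]
    exact Finset.sum_congr rfl fun f _ => by ring
  constructor <;> linarith

/-- With u = `π none`, known partners contribute (1 - u)s/2 for each argument, and unknown ones at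
most u. -/
theorem limit_live_le (ha : IsSymmetricDistribution a) {π : Option Bool → ℝ}
    (hπ0 : ∀ α, 0 ≤ π α) (hπ1 : ∑ α, π α = 1) (hπ : π (some true) = π (some false)) :
    ∑ β, π β * ∑ f, a f * ind (LiveFst f β) ≤ (sensitivity a + 2 * π none) / 2 ∧
    ∑ β, π β * ∑ f, a f * ind (LiveSnd f β) ≤ (sensitivity a + 2 * π none) / 2 := by
  have hle : ∀ P : BoolFun → Prop, ∑ f, a f * ind (P f) ≤ 1 := by
    intro P
    rw [← ha.sum_eq_one]
    exact Finset.sum_le_sum fun f _ => mul_le_of_le_one_right (ha.nonneg f) (ind_le_one _)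
  have hp : 2 * π (some false) = 1 - π none := by
    simp only [Fintype.sum_option, Fintype.sum_bool, hπ] at hπ1
    linarith
  obtain ⟨h1, h2⟩ := sum_live_eq ha
  simp_rw [mul_add, Finset.sum_add_distrib] at h1 h2
  have hnn := sensitivity_nonneg ha
  have hu := hπ0 none
  have key : ∀ H : Option Bool → ℝ, H (some true) + H (some false) = sensitivity a →
      H none ≤ 1 → ∑ β, π β * H β ≤ (sensitivity a + 2 * π none) / 2 := by
    intro H hH hH1
    simp only [Fintype.sum_option, Fintype.sum_bool, hπ]
    nlinarith [mul_le_mul_of_nonneg_left hH1 hu, mul_nonneg hu hnn]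
  exact ⟨key (fun β => ∑ f, a f * ind (LiveFst f β)) h1 (hle _),
    key (fun β => ∑ f, a f * ind (LiveSnd f β)) h2 (hle _)⟩

/-! ### Concentration of the proportions of statuses -/

/-- The deviation from its mean of the indicator that the gate `g` gets the status `α`. -/
noncomputable def dev (a : BoolFun → ℝ) (α : Option Bool) (s : Fin n → Option Bool)
    (g : Gate n) : ℝ :=
  ind (force g.2 (s g.1.val.1) (s g.1.val.2) = α) - statusProb a s α

theorem statusProb_mem (ha : IsSymmetricDistribution a) (hn : 2 ≤ n) (s : Fin n → Option Bool)
    (α : Option Bool) : 0 ≤ statusProb a s α ∧ statusProb a s α ≤ 1 := by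
  refine ⟨gateMean_nonneg ha fun g => ind_nonneg _, ?_⟩
  rw [← gateMean_const ha hn 1]
  exact gateMean_mono ha fun g => ind_le_one _

theorem abs_dev_le (ha : IsSymmetricDistribution a) (hn : 2 ≤ n) (α : Option Bool)
    (s : Fin n → Option Bool) (g : Gate n) : |dev a α s g| ≤ 1 := by
  obtain ⟨h1, h2⟩ := statusProb_mem ha hn s α
  have h3 := ind_nonneg (force g.2 (s g.1.val.1) (s g.1.val.2) = α)
  have h4 := ind_le_one (force g.2 (s g.1.val.1) (s g.1.val.2) = α)
  unfold dev
  rw [abs_le]; constructor <;> linarith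

theorem gateMean_dev (ha : IsSymmetricDistribution a) (hn : 2 ≤ n) (α : Option Bool)
    (s : Fin n → Option Bool) : gateMean a (dev a α s) = 0 := by
  unfold dev
  rw [gateMean_sub, gateMean_const ha hn]
  exact sub_self _

theorem abs_dev_sub_le (ha : IsSymmetricDistribution a) (hn : 2 ≤ n) (α : Option Bool)
    {s s' : Fin n → Option Bool} (T : Finset (Fin n)) (hT : ∀ i ∉ T, s' i = s i) (g : Gate n) :
    |dev a α s g - dev a α s' g| ≤ ind (∃ t ∈ T, HasInput g t) + T.card * (2 / n) := by
  have h1 : ∀ g : Gate n, |ind (force g.2 (s g.1.val.1) (s g.1.val.2) = α)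
      - ind (force g.2 (s' g.1.val.1) (s' g.1.val.2) = α)| ≤ ind (∃ t ∈ T, HasInput g t) := by
    intro g
    by_cases hg : ∃ t ∈ T, HasInput g t
    · rw [ind_true hg]
      have h1 := ind_nonneg (force g.2 (s g.1.val.1) (s g.1.val.2) = α)
      have h2 := ind_le_one (force g.2 (s g.1.val.1) (s g.1.val.2) = α)
      have h3 := ind_nonneg (force g.2 (s' g.1.val.1) (s' g.1.val.2) = α)
      have h4 := ind_le_one (force g.2 (s' g.1.val.1) (s' g.1.val.2) = α)
      rw [abs_le]; constructor <;> linarith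
    · push Not at hg
      have e1 : s' g.1.val.1 = s g.1.val.1 := hT _ fun h => hg _ h (Or.inl rfl)
      have e2 : s' g.1.val.2 = s g.1.val.2 := hT _ fun h => hg _ h (Or.inr rfl)
      rw [e1, e2, sub_self, abs_zero]
      exact ind_nonneg _
  have h2 : |statusProb a s α - statusProb a s' α| ≤ T.card * (2 / n) := by
    unfold statusProb
    rw [← gateMean_sub]
    exact (gateMean_abs_le ha _).trans
      ((gateMean_mono ha h1).trans (gateMean_hasInput_mem_le ha hn T))
  have e : dev a α s g - dev a α s' g = (ind (force g.2 (s g.1.val.1) (s g.1.val.2) = α)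
      - ind (force g.2 (s' g.1.val.1) (s' g.1.val.2) = α))
      - (statusProb a s α - statusProb a s' α) := by unfold dev; ring
  rw [e]
  exact (abs_sub _ _).trans (add_le_add (h1 g) h2)

/-- Leaving out `R` matters to the gate `j` only if one of its inputs lies in `reach B R τ`. That
set is small and, as `j ∈ R`, independent of the gate `j`. -/
theorem expect_abs_dev_sub_le (ha : IsSymmetricDistribution a) (hn : 2 ≤ n) (α : Option Bool)
    (τ D : ℕ) (R : Finset (Fin n)) {j : Fin n} (hj : j ∈ R) :
    expect a (fun B => |dev a α (status B ∅ τ) (B j) - dev a α (status B R τ) (B j)|)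
      ≤ 2 * pr a n (fun B => ¬ SmallOutdegree D B)
        + 4 * ((R.card * (1 + D) ^ τ : ℕ) : ℝ) / n := by
  set M := R.card * (1 + D) ^ τ
  -- The cutoff is put on the size of `reach`, not on the outdegrees, so that `Z` can be averaged
  -- over the gate `j` with everything else fixed.
  set Z : Automaton n → ℝ := fun B => ind ((reach B R τ).card ≤ M) *
    (ind (∃ t ∈ reach B R τ, HasInput (B j) t) + (reach B R τ).card * (2 / n))
  have hpt : ∀ B : Automaton n,
      |dev a α (status B ∅ τ) (B j) - dev a α (status B R τ) (B j)|
        ≤ 2 * ind (¬ SmallOutdegree D B) + Z B := by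
    intro B
    by_cases hM : (reach B R τ).card ≤ M
    · simp only [Z, ind_true hM, one_mul]
      have := abs_dev_sub_le ha hn α (reach B R τ) (status_eq_of_notMem_reach B R τ) (B j)
      linarith [ind_nonneg (¬ SmallOutdegree D B)]
    · have hD : ¬ SmallOutdegree D B := fun h => hM (card_reach_le h R τ)
      simp only [Z, ind_true hD, ind_false hM]
      have h1 := abs_dev_le ha hn α (status B ∅ τ) (B j)
      have h2 := abs_dev_le ha hn α (status B R τ) (B j)
      have := abs_sub (dev a α (status B ∅ τ) (B j)) (dev a α (status B R τ) (B j))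
      linarith
  have hZ : expect a Z ≤ 4 * (M : ℝ) / n := by
    rw [expect_resample ha hn j, ← expect_const ha hn (4 * (M : ℝ) / n)]
    refine expect_mono ha fun B => ?_
    have e : ∀ g, Z (Function.update B j g) = ind ((reach B R τ).card ≤ M) *
        (ind (∃ t ∈ reach B R τ, HasInput g t) + (reach B R τ).card * (2 / n)) := by
      intro g
      have := reach_ignores R τ j hj B g
      simp only at this
      simp only [Z, this, Function.update_self]
    simp_rw [e]
    rw [gateMean_mul_left, gateMean_add, gateMean_const ha hn]
    have h1 := gateMean_hasInput_mem_le ha hn (reach B R τ)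
    by_cases hM : (reach B R τ).card ≤ M
    · rw [ind_true hM, one_mul]
      have hM' : ((reach B R τ).card : ℝ) ≤ M := by exact_mod_cast hM
      have : ((reach B R τ).card : ℝ) * (2 / n) ≤ M * (2 / n) :=
        mul_le_mul_of_nonneg_right hM' (by positivity)
      have e4 : 4 * (M : ℝ) / n = M * (2 / n) + M * (2 / n) := by ring
      linarith
    · rw [ind_false hM, zero_mul]; positivity
  calc _ ≤ expect a (fun B => 2 * ind (¬ SmallOutdegree D B) + Z B) := expect_mono ha hpt
    _ ≤ _ := by
      rw [expect_add, expect_mul_left, ← pr_eq]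
      linarith

/-- Once both gates are left out, the statuses do not depend on them, and averaging over the gate
`j` gives zero. What remains is the cost of leaving them out, incurred twice. -/
theorem expect_dev_mul_dev_le (ha : IsSymmetricDistribution a) (hn : 2 ≤ n) (α : Option Bool)
    (τ D : ℕ) {j k : Fin n} (hjk : j ≠ k) :
    expect a (fun B => dev a α (status B ∅ τ) (B j) * dev a α (status B ∅ τ) (B k))
      ≤ 4 * pr a n (fun B => ¬ SmallOutdegree D B) + 16 * ((1 + D : ℕ) : ℝ) ^ τ / n := by
  set R : Finset (Fin n) := {j, k}
  have hj : j ∈ R := by simp [R]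
  have hk : k ∈ R := by simp [R]
  have hR : R.card = 2 := Finset.card_pair hjk
  have hzero : expect a (fun B => dev a α (status B R τ) (B j) * dev a α (status B R τ) (B k))
      = 0 := by
    rw [expect_resample ha hn j, ← expect_const (n := n) ha hn 0]
    congr 1
    funext B
    have e : ∀ g, dev a α (status (Function.update B j g) R τ) (Function.update B j g j)
        * dev a α (status (Function.update B j g) R τ) (Function.update B j g k)
        = dev a α (status B R τ) g * dev a α (status B R τ) (B k) := by
      intro g
      have := status_ignores R τ j hj B g
      simp only at this
      rw [this, Function.update_self, Function.update_of_ne hjk.symm]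
    simp_rw [e]
    rw [gateMean_mul_right]
    have := gateMean_dev ha hn α (status B R τ)
    rw [this, zero_mul]
  have h1 := expect_abs_dev_sub_le ha hn α τ D R hj
  have h2 := expect_abs_dev_sub_le ha hn α τ D R hk
  have hpt : ∀ B : Automaton n, dev a α (status B ∅ τ) (B j) * dev a α (status B ∅ τ) (B k)
      ≤ dev a α (status B R τ) (B j) * dev a α (status B R τ) (B k)
        + (|dev a α (status B ∅ τ) (B j) - dev a α (status B R τ) (B j)|
        + |dev a α (status B ∅ τ) (B k) - dev a α (status B R τ) (B k)|) := by
    intro B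
    set x := dev a α (status B ∅ τ) (B j)
    set y := dev a α (status B ∅ τ) (B k)
    set x' := dev a α (status B R τ) (B j)
    set y' := dev a α (status B R τ) (B k)
    have hx : |x'| ≤ 1 := abs_dev_le ha hn α _ _
    have hy : |y| ≤ 1 := abs_dev_le ha hn α _ _
    have e : x * y - x' * y' = (x - x') * y + x' * (y - y') := by ring
    have b1 : (x - x') * y ≤ |x - x'| := (le_abs_self _).trans <| by
      rw [abs_mul]; exact mul_le_of_le_one_right (abs_nonneg _) hy
    have b2 : x' * (y - y') ≤ |y - y'| := (le_abs_self _).trans <| by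
      rw [abs_mul]; exact mul_le_of_le_one_left (abs_nonneg _) hx
    linarith
  refine (expect_mono ha hpt).trans ?_
  rw [expect_add, expect_add, hzero]
  rw [hR] at h1 h2
  push_cast at h1 h2 ⊢
  have e : 16 * (1 + (D : ℝ)) ^ τ / n = 4 * (2 * (1 + (D : ℝ)) ^ τ) / n
      + 4 * (2 * (1 + (D : ℝ)) ^ τ) / n := by ring
  linarith

/-- The bound on the relative variance of the number of gates with a given status. -/
noncomputable def varBound (a : BoolFun → ℝ) (n τ D : ℕ) : ℝ :=
  1 / n + 4 * pr a n (fun B => ¬ SmallOutdegree D B) + 16 * ((1 + D : ℕ) : ℝ) ^ τ / n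

theorem cnt_sub_eq_sum_dev (B : Automaton n) (τ : ℕ) (α : Option Bool) {u : ℕ} (hu : u ≤ n) :
    cnt (status B ∅ (τ + 1)) u α - u * statusProb a (status B ∅ τ) α
      = ∑ w : Fin n with w.val < u, dev a α (status B ∅ τ) (B w) := by
  unfold dev cnt
  rw [Finset.sum_sub_distrib, Finset.sum_const, nsmul_eq_mul]
  have : (Finset.univ.filter fun w : Fin n => w.val < u).card = u := by
    rw [Fin.card_filter_val_lt]; exact min_eq_right hu
  rw [this]
  simp [status]

/-- The centring is itself random: `statusProb` is taken at the actual statuses at time `τ`.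
Diagonal terms contribute at most n, the others are nearly uncorrelated. -/
theorem expect_sq_cnt_sub_le (ha : IsSymmetricDistribution a) (hn : 2 ≤ n) (α : Option Bool)
    (τ D : ℕ) {u : ℕ} (hu : u ≤ n) :
    expect a (fun B : Automaton n => (cnt (status B ∅ (τ + 1)) u α
      - u * statusProb a (status B ∅ τ) α) ^ 2) ≤ n ^ 2 * varBound a n τ D := by
  set E : ℝ := 4 * pr a n (fun B => ¬ SmallOutdegree D B) + 16 * ((1 + D : ℕ) : ℝ) ^ τ / n
  have hE : 0 ≤ E := by
    have := pr_nonneg ha (fun B : Automaton n => ¬ SmallOutdegree D B)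
    positivity
  have hn0 : (n : ℝ) ≠ 0 := by positivity
  simp_rw [cnt_sub_eq_sum_dev _ τ α hu, sq, Finset.sum_mul_sum]
  rw [expect_sum]
  simp_rw [expect_sum]
  have hterm : ∀ j k : Fin n,
      expect a (fun B => dev a α (status B ∅ τ) (B j) * dev a α (status B ∅ τ) (B k))
        ≤ (if j = k then 1 else 0) + E := by
    intro j k
    split_ifs with h
    · subst h
      have : expect a (fun B => dev a α (status B ∅ τ) (B j) * dev a α (status B ∅ τ) (B j))
          ≤ 1 := by
        rw [← expect_const (n := n) ha hn 1]
        refine expect_mono ha fun B => ?_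
        have := abs_le.mp (abs_dev_le ha hn α (status B ∅ τ) (B j))
        nlinarith [this.1, this.2]
      linarith
    · rw [zero_add]; exact expect_dev_mul_dev_le ha hn α τ D h
  calc _ ≤ ∑ j : Fin n with j.val < u, ∑ k : Fin n with k.val < u,
          ((if j = k then 1 else 0) + E) :=
        Finset.sum_le_sum fun j _ => Finset.sum_le_sum fun k _ => hterm j k
    _ ≤ ∑ j : Fin n, ∑ k : Fin n, ((if j = k then 1 else 0) + E) := by
        refine (Finset.sum_le_sum fun j _ => Finset.sum_le_sum_of_subset_of_nonneg
          (Finset.filter_subset _ _) fun k _ _ => by positivity).trans ?_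
        exact Finset.sum_le_sum_of_subset_of_nonneg (Finset.filter_subset _ _)
          fun j _ _ => Finset.sum_nonneg fun k _ => by positivity
    _ = n + n ^ 2 * E := by
        simp only [Finset.sum_add_distrib, Finset.sum_ite_eq, Finset.mem_univ, if_true,
          Finset.sum_const, Finset.card_univ, Fintype.card_fin, nsmul_eq_mul, mul_one]
        ring
    _ = n * n * varBound a n τ D := by
        unfold varBound; simp only [E]; field_simp; ring

theorem pr_cnt_sub_gt_le (ha : IsSymmetricDistribution a) (hn : 2 ≤ n) (α : Option Bool)
    (τ D : ℕ) {u : ℕ} (hu : u ≤ n) {δ : ℝ} (hδ : 0 < δ) :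
    pr a n (fun B => δ * n < |cnt (status B ∅ (τ + 1)) u α
      - u * statusProb a (status B ∅ τ) α|) ≤ varBound a n τ D / δ ^ 2 := by
  have hn0 : (0 : ℝ) < n := by positivity
  have hpt : ∀ B : Automaton n, ind (δ * n < |cnt (status B ∅ (τ + 1)) u α
      - u * statusProb a (status B ∅ τ) α|) ≤ (cnt (status B ∅ (τ + 1)) u α
      - u * statusProb a (status B ∅ τ) α) ^ 2 * (1 / (δ * n) ^ 2) := by
    intro B
    by_cases h : δ * n < |cnt (status B ∅ (τ + 1)) u α - u * statusProb a (status B ∅ τ) α|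
    · rw [ind_true h, mul_one_div, le_div_iff₀ (by positivity), one_mul, ← sq_abs (_ - _)]
      exact pow_le_pow_left₀ (by positivity) h.le 2
    · rw [ind_false h]; positivity
  rw [pr_eq]
  refine (expect_mono ha hpt).trans ?_
  rw [expect_mul_right]
  refine (mul_le_mul_of_nonneg_right (expect_sq_cnt_sub_le ha hn α τ D hu)
    (by positivity)).trans (le_of_eq ?_)
  field_simp

theorem cnt_mono_sub_le (s : Fin n → Option Bool) (α : Option Bool) {u v : ℕ} (huv : u ≤ v)
    (hv : v ≤ n) : |cnt s v α - cnt s u α| ≤ (v : ℝ) - u := by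
  have e : cnt s v α - cnt s u α
      = ∑ w : Fin n with (w.val < v ∧ ¬ w.val < u), ind (s w = α) := by
    unfold cnt
    rw [sub_eq_iff_eq_add, Finset.sum_filter, Finset.sum_filter, Finset.sum_filter,
      ← Finset.sum_add_distrib]
    refine Finset.sum_congr rfl fun w _ => ?_
    by_cases h1 : w.val < u
    · have h2 : w.val < v := by omega
      simp [h1, h2]
    · by_cases h2 : w.val < v <;> simp [h1, h2]
  have hc : ∀ u ≤ n, ∑ w : Fin n with w.val < u, (1 : ℝ) = u := by
    intro u hu
    rw [Finset.sum_const, Fin.card_filter_val_lt, min_eq_right hu]; simp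
  have e2 : ∑ w : Fin n with (w.val < v ∧ ¬ w.val < u), (1 : ℝ) = v - u := by
    rw [← hc v hv, ← hc u (huv.trans hv), eq_sub_iff_add_eq, Finset.sum_filter,
      Finset.sum_filter, Finset.sum_filter, ← Finset.sum_add_distrib]
    refine Finset.sum_congr rfl fun w _ => ?_
    by_cases h1 : w.val < u
    · have h2 : w.val < v := by omega
      simp [h1, h2]
    · by_cases h2 : w.val < v <;> simp [h1, h2]
  rw [e, abs_of_nonneg (Finset.sum_nonneg fun _ _ => ind_nonneg _), ← e2]
  exact Finset.sum_le_sum fun w _ => ind_le_one _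

/-- The factor 111 is made up of 108 for replacing `statusProb` by its limit, and of 1 each for the
fluctuation at a grid point, for the count between grid points and for the limit between grid
points. -/
theorem pr_not_balanced_succ_le (ha : IsSymmetricDistribution a) (hn : 2 ≤ n) (τ D : ℕ) {δ : ℝ}
    (hδ : 0 < δ) (hδn : 1 ≤ δ * n) :
    pr a n (fun B => ¬ Balanced (status B ∅ (τ + 1)) (limitStatus a (τ + 1)) (111 * δ))
      ≤ pr a n (fun B => ¬ Balanced (status B ∅ τ) (limitStatus a τ) δ)
        + 3 * ((⌈2 / δ⌉₊ + 1 : ℕ) : ℝ) * (varBound a n τ D / δ ^ 2) := by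
  -- A grid of spacing `h` reduces all initial segments to a number of them that does not depend on
  -- n.
  set h := ⌊δ * n⌋₊
  have hh1 : 1 ≤ h := Nat.le_floor (by simpa using hδn)
  have hh : (h : ℝ) ≤ δ * n := Nat.floor_le (by positivity)
  have hh2 : δ * n ≤ 2 * h := by
    have := Nat.lt_floor_add_one (δ * n)
    have h1 : (1 : ℝ) ≤ h := by exact_mod_cast hh1
    linarith
  set S : Finset (Option Bool × ℕ) := Finset.univ ×ˢ Finset.range (⌈2 / δ⌉₊ + 1)
  set bad : Option Bool × ℕ → Automaton n → Prop := fun q B =>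
    δ * n < |cnt (status B ∅ (τ + 1)) (min (q.2 * h) n) q.1
      - (min (q.2 * h) n : ℕ) * statusProb a (status B ∅ τ) q.1|
  have himp : ∀ B : Automaton n,
      ¬ Balanced (status B ∅ (τ + 1)) (limitStatus a (τ + 1)) (111 * δ) →
      ¬ Balanced (status B ∅ τ) (limitStatus a τ) δ ∨ ∃ q ∈ S, bad q B := by
    intro B hB
    by_contra hcon
    push Not at hcon
    obtain ⟨hbal, hgood⟩ := hcon
    refine hB fun u hu α => ?_
    set r := u / h
    have hr1 : r * h ≤ u := Nat.div_mul_le_self u h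
    have hr2 : u < r * h + h := by
      have := Nat.lt_div_mul_add (a := u) (b := h) hh1; exact this
    have hrS : r ∈ Finset.range (⌈2 / δ⌉₊ + 1) := by
      rw [Finset.mem_range, Nat.lt_succ_iff]
      have : (r : ℝ) ≤ 2 / δ := by
        have hrn : ((r * h : ℕ) : ℝ) ≤ n := by exact_mod_cast hr1.trans hu
        push_cast at hrn
        rw [le_div_iff₀ hδ]
        have hn0 : (0 : ℝ) < n := by positivity
        have hr0 : (0 : ℝ) ≤ r := by positivity
        have := mul_le_mul_of_nonneg_left hh2 hr0
        nlinarith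
      exact_mod_cast this.trans (Nat.le_ceil _)
    have hg := hgood (α, r) (Finset.mk_mem_product (Finset.mem_univ α) hrS)
    simp only [bad, not_lt] at hg
    rw [min_eq_left (hr1.trans hu)] at hg
    have hp := hbal.statusProb_sub_le ha hn hδ.le (limitStatus_nonneg ha τ)
      (limitStatus_le_one ha τ) α
    have hc := cnt_mono_sub_le (status B ∅ (τ + 1)) α hr1 hu
    have hπ0 := limitStatus_nonneg ha (τ + 1) α
    have hπ1 := limitStatus_le_one ha (τ + 1) α
    have hnext : nextStatus a (limitStatus a τ) α = limitStatus a (τ + 1) α := rfl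
    rw [hnext] at hp
    have hub : (u : ℝ) - (r * h : ℕ) ≤ δ * n := by
      have : (u : ℝ) ≤ (r * h : ℕ) + h := by exact_mod_cast hr2.le
      linarith
    have hub0 : (0 : ℝ) ≤ (u : ℝ) - (r * h : ℕ) := by
      have : ((r * h : ℕ) : ℝ) ≤ u := by exact_mod_cast hr1
      linarith
    set p := statusProb a (status B ∅ τ) α
    set π := limitStatus a (τ + 1) α
    set y : ℝ := ((r * h : ℕ) : ℝ)
    have hy0 : 0 ≤ y := by positivity
    have hyn : y ≤ n := by
      have : y ≤ u := by linarith
      exact this.trans (by exact_mod_cast hu)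
    have e : cnt (status B ∅ (τ + 1)) u α - π * u
        = (cnt (status B ∅ (τ + 1)) u α - cnt (status B ∅ (τ + 1)) (r * h) α)
        + (cnt (status B ∅ (τ + 1)) (r * h) α - y * p) + (y * (p - π) - π * (u - y)) := by ring
    have b3 : |y * (p - π) - π * (u - y)| ≤ 108 * δ * n + δ * n := by
      refine (abs_sub _ _).trans (add_le_add ?_ ?_)
      · rw [abs_mul, abs_of_nonneg hy0]
        calc y * |p - π| ≤ n * (108 * δ) := mul_le_mul hyn hp (abs_nonneg _) (by positivity)
          _ = _ := by ring
      · rw [abs_mul, abs_of_nonneg hπ0, abs_of_nonneg hub0]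
        exact (mul_le_of_le_one_left hub0 hπ1).trans hub
    rw [e]
    refine (abs_add_le _ _).trans ?_
    have b12 := abs_add_le (cnt (status B ∅ (τ + 1)) u α - cnt (status B ∅ (τ + 1)) (r * h) α)
      (cnt (status B ∅ (τ + 1)) (r * h) α - y * p)
    linarith
  refine (pr_mono ha himp).trans ((pr_or_le ha _ _).trans (add_le_add le_rfl ?_))
  refine (pr_exists_le_sum ha S bad).trans ?_
  calc ∑ q ∈ S, pr a n (bad q) ≤ ∑ q ∈ S, varBound a n τ D / δ ^ 2 :=
        Finset.sum_le_sum fun q _ => pr_cnt_sub_gt_le ha hn q.1 τ D (min_le_right _ _) hδ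
    _ = _ := by
        rw [Finset.sum_const, nsmul_eq_mul]
        simp [S, Finset.card_product]

/-! ### Limits as n tends to infinity -/

/-- A logarithmic scale. -/
def logScale (n : ℕ) : ℕ := Nat.log 2 n + 1

theorem lt_two_pow_logScale (n : ℕ) : n < 2 ^ logScale n :=
  Nat.lt_pow_succ_log_self (by norm_num) n

theorem tendsto_logScale : Tendsto logScale atTop atTop := by
  refine tendsto_atTop_atTop.mpr fun b => ⟨2 ^ b, fun n hn => ?_⟩
  exact (Nat.le_log_of_pow_le (by norm_num) hn).trans (Nat.le_succ _)

theorem tendsto_logScale_pow_div (k : ℕ) :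
    Tendsto (fun n : ℕ => (logScale n : ℝ) ^ k / n) atTop (𝓝 0) := by
  have h := (tendsto_pow_const_div_const_pow_of_one_lt k (r := 2) (by norm_num)).comp
    tendsto_logScale
  have h2 := h.const_mul 2
  rw [mul_zero] at h2
  refine squeeze_zero' (Eventually.of_forall fun n => by positivity) ?_ h2
  filter_upwards [eventually_ge_atTop 1] with n hn
  have : (2 : ℝ) ^ logScale n ≤ 2 * n := by
    have := Nat.pow_log_le_self 2 (show n ≠ 0 by omega)
    have h' : 2 ^ logScale n ≤ 2 * n := by unfold logScale; rw [pow_succ]; omega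
    exact_mod_cast h'
  have hn0 : (0 : ℝ) < n := by positivity
  simp only [Function.comp]
  rw [mul_div_assoc', div_le_div_iff₀ hn0 (by positivity)]
  have hk : (0 : ℝ) ≤ (logScale n : ℝ) ^ k := by positivity
  nlinarith

theorem tendsto_pr_not_smallOutdegree (ha : IsSymmetricDistribution a) :
    Tendsto (fun n => pr a n (fun B => ¬ SmallOutdegree (2 * logScale n) B)) atTop (𝓝 0) := by
  have h : Tendsto (fun n : ℕ => Real.exp 2 * ((logScale n : ℝ) ^ 0 / n)) atTop (𝓝 0) := by
    simpa using (tendsto_logScale_pow_div 0).const_mul (Real.exp 2)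
  refine squeeze_zero' (Eventually.of_forall fun n => pr_nonneg ha _) ?_ h
  filter_upwards [eventually_ge_atTop 2] with n hn
  refine (pr_not_smallOutdegree_le ha hn _).trans ?_
  have hlt : (n : ℝ) < 2 ^ logScale n := by exact_mod_cast lt_two_pow_logScale n
  have hn0 : (0 : ℝ) < n := by positivity
  rw [pow_zero, mul_one_div, mul_comm 2, pow_mul, div_le_div_iff₀ (by positivity) hn0]
  -- The factor 2 in the outdegree bound makes 2^D at least n², which beats the union bound over n
  -- gates.
  have : (n : ℝ) * n ≤ (2 ^ logScale n) ^ 2 := by rw [sq]; gcongr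
  have he := Real.exp_pos 2
  nlinarith

theorem tendsto_varBound (ha : IsSymmetricDistribution a) (τ : ℕ) :
    Tendsto (fun n => varBound a n τ (2 * logScale n)) atTop (𝓝 0) := by
  have h1 : Tendsto (fun n : ℕ => 1 / (n : ℝ)) atTop (𝓝 0) := tendsto_one_div_atTop_nhds_zero_nat
  have h2 := (tendsto_pr_not_smallOutdegree ha).const_mul 4
  have h3 : Tendsto (fun n : ℕ => 16 * ((1 + 2 * logScale n : ℕ) : ℝ) ^ τ / n) atTop (𝓝 0) := by
    have h4 := (tendsto_logScale_pow_div τ).const_mul (16 * 3 ^ τ)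
    rw [mul_zero] at h4
    refine squeeze_zero (fun n => by positivity) (fun n => ?_) h4
    rw [mul_div_assoc']
    refine div_le_div_of_nonneg_right ?_ (by positivity)
    have : ((1 + 2 * logScale n : ℕ) : ℝ) ≤ 3 * logScale n := by
      have : 1 + 2 * logScale n ≤ 3 * logScale n := by unfold logScale; omega
      exact_mod_cast this
    calc _ ≤ 16 * (3 * (logScale n : ℝ)) ^ τ := by gcongr
      _ = _ := by rw [mul_pow]; ring
  simpa [varBound] using (h1.add h2).add h3

theorem tendsto_pr_not_balanced (ha : IsSymmetricDistribution a) (τ : ℕ) :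
    ∀ ε > 0, Tendsto (fun n => pr a n (fun B => ¬ Balanced (status B ∅ τ) (limitStatus a τ) ε))
      atTop (𝓝 0) := by
  induction τ with
  | zero =>
    intro ε hε
    refine tendsto_const_nhds.congr fun n => ?_
    have : ∀ B : Automaton n, ¬ Balanced (status B ∅ 0) (limitStatus a 0) ε ↔ False := by
      intro B
      refine iff_of_false (not_not.mpr fun u hu α => ?_) id
      have : cnt (status B ∅ 0) u α = limitStatus a 0 α * u := by
        unfold cnt
        simp only [status, limitStatus]
        rw [Finset.sum_const, Fin.card_filter_val_lt, min_eq_right hu, nsmul_eq_mul, mul_comm]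
        congr 2
        exact propext eq_comm
      rw [this, sub_self, abs_zero]
      positivity
    simp_rw [this]
    rw [pr_eq]
    simp [expect]
  | succ τ ih =>
    intro ε hε
    have hδ : 0 < ε / 111 := by positivity
    have h := (ih _ hδ).add
      (((tendsto_varBound ha τ).div_const ((ε / 111) ^ 2)).const_mul
        (3 * ((⌈2 / (ε / 111)⌉₊ + 1 : ℕ) : ℝ)))
    simp only [zero_div, mul_zero, add_zero] at h
    refine squeeze_zero' (Eventually.of_forall fun n => pr_nonneg ha _) ?_ h
    have hlarge : ∀ᶠ n : ℕ in atTop, 1 ≤ ε / 111 * n := by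
      have : Tendsto (fun n : ℕ => ε / 111 * (n : ℝ)) atTop atTop :=
        tendsto_natCast_atTop_atTop.const_mul_atTop hδ
      exact this.eventually_ge_atTop 1
    filter_upwards [eventually_ge_atTop 2, hlarge] with n hn hn1
    have := pr_not_balanced_succ_le ha hn τ (2 * logScale n) hδ hn1
    rwa [mul_div_cancel₀ ε (by norm_num : (111 : ℝ) ≠ 0)] at this

/-! ### Trajectories on digraphs without long paths and bicycles -/

section Digraph

variable {V : Type*} {E : V → V → Prop} {L : ℕ}

open Relation

/-- Some cycle leads to `u`. -/
def Rooted (E : V → V → Prop) (u : V) : Prop := ∃ v, TransGen E v v ∧ ReflTransGen E v u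

theorem Rooted.exists_pred {u : V} (h : Rooted E u) : ∃ w, Rooted E w ∧ E w u := by
  obtain ⟨v, hv, hvu⟩ := h
  rcases ReflTransGen.cases_tail hvu with rfl | ⟨w, hvw, hwu⟩
  · obtain ⟨w, hvw, hwv⟩ := TransGen.tail'_iff.mp hv
    exact ⟨w, ⟨_, hv, hvw⟩, hwv⟩
  · exact ⟨w, ⟨v, hv, hvw⟩, hwu⟩

theorem transGen_of_walk {z : ℕ → V} {k : ℕ} (hz : ∀ i < k, E (z (i + 1)) (z i)) {i j : ℕ}
    (hij : i < j) (hj : j ≤ k) : TransGen E (z j) (z i) := by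
  induction j, hij using Nat.le_induction with
  | base => exact TransGen.single (hz i hj)
  | succ j _ ih => exact (TransGen.single (hz j hj)).trans (ih (by omega))

/-- A path contains a simple path with the same ends. -/
theorem exists_nodup_chain (x : V) (l : List V) (h : (x :: l).IsChain E) :
    ∃ l', (x :: l').IsChain E ∧ (x :: l').Nodup ∧
      (x :: l').getLast (List.cons_ne_nil _ _) = (x :: l).getLast (List.cons_ne_nil _ _) := by
  induction l generalizing x with
  | nil => exact ⟨[], by simp, by simp, rfl⟩
  | cons y l ih =>
    rw [List.isChain_cons_cons] at h
    obtain ⟨l', h1, h2, h3⟩ := ih y h.2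
    by_cases hx : x ∈ y :: l'
    · obtain ⟨p, q, hpq⟩ := List.append_of_mem hx
      refine ⟨q, ?_, ?_, ?_⟩
      · rw [hpq] at h1; exact h1.right_of_append
      · rw [hpq] at h2; exact h2.of_append_right
      · rw [List.getLast_cons_cons, ← h3]
        simp only [hpq]
        rw [List.getLast_append_of_ne_nil _ (List.cons_ne_nil _ _)]
    · refine ⟨y :: l', ?_, ?_, ?_⟩
      · rw [List.isChain_cons_cons]; exact ⟨h.1, h1⟩
      · rw [List.nodup_cons]; exact ⟨hx, h2⟩
      · rw [List.getLast_cons_cons, List.getLast_cons_cons, h3]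

theorem exists_cycle {v : V} (hv : TransGen E v v) :
    ∃ c, (v :: c).IsChain E ∧ (v :: c).Nodup ∧ E ((v :: c).getLast (List.cons_ne_nil _ _)) v := by
  obtain ⟨w, hvw, hwv⟩ := TransGen.tail'_iff.mp hv
  obtain ⟨l, hl, hlast⟩ := List.exists_isChain_cons_of_relationReflTransGen hvw
  obtain ⟨c, h1, h2, h3⟩ := exists_nodup_chain v l hl
  exact ⟨c, h1, h2, by rw [h3, hlast]; exact hwv⟩

theorem chain_reach (x : V) (l : List V) (h : (x :: l).IsChain E) :
    ReflTransGen E x ((x :: l).getLast (List.cons_ne_nil _ _)) ∧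
    ∀ y ∈ l, ReflTransGen E x y ∧
      ReflTransGen E y ((x :: l).getLast (List.cons_ne_nil _ _)) := by
  induction l generalizing x with
  | nil => simpa using ReflTransGen.refl
  | cons y l ih =>
    rw [List.isChain_cons_cons] at h
    obtain ⟨h1, h2⟩ := ih y h.2
    rw [List.getLast_cons_cons]
    refine ⟨ReflTransGen.head h.1 h1, fun w hw => ?_⟩
    rcases List.mem_cons.mp hw with rfl | hw
    · exact ⟨ReflTransGen.single h.1, h1⟩
    · exact ⟨ReflTransGen.head h.1 (h2 w hw).1, (h2 w hw).2⟩

/-- Every simple path has at most `L` vertices. -/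
def ShortPaths (E : V → V → Prop) (L : ℕ) : Prop :=
  ∀ l : List V, l.Nodup → l.IsChain E → l.length ≤ L

/-- If there are edges from a vertex of a simple path to its head and from its last vertex to
a vertex of it, then they are the same edge. -/
def NoBicycle (E : V → V → Prop) : Prop :=
  ∀ (x : V) (l : List V), (x :: l).Nodup → (x :: l).IsChain E → ∀ a ∈ x :: l, ∀ b ∈ x :: l,
    E a x → E ((x :: l).getLast (List.cons_ne_nil _ _)) b →
    a = (x :: l).getLast (List.cons_ne_nil _ _) ∧ b = x

/-- Rooted predecessors are prepended until one already lies on the path. The bound on simple paths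
makes this stop; `k` is the room left. -/
theorem exists_extension (H1 : ShortPaths E L) (k : ℕ) (x : V) (l : List V)
    (hk : L < (x :: l).length + k) (hnd : (x :: l).Nodup) (hch : (x :: l).IsChain E)
    (hx : Rooted E x) :
    ∃ y l', (y :: l').Nodup ∧ (y :: l').IsChain E ∧ (x :: l) <:+ (y :: l') ∧
      ∃ a ∈ y :: l', E a y := by
  induction k generalizing x l with
  | zero =>
    have := H1 _ hnd hch
    omega
  | succ k ih =>
    obtain ⟨w, hw, hwx⟩ := hx.exists_pred
    by_cases hmem : w ∈ x :: l
    · exact ⟨x, l, hnd, hch, List.suffix_rfl, w, hmem, hwx⟩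
    · obtain ⟨y, l', h1, h2, h3, h4⟩ := ih w (x :: l)
        (by simp only [List.length_cons] at hk ⊢; omega)
        (List.nodup_cons.mpr ⟨hmem, hnd⟩) (List.isChain_cons_cons.mpr ⟨hwx, hch⟩) hw
      exact ⟨y, l', h1, h2, (List.suffix_cons w _).trans h3, h4⟩

/-- Extending the cycle backwards through `u` gives a simple path that ends with the cycle and whose
head has an in-neighbour on it. Together with the closing edge of the cycle this is a bicycle,
because `v` is not the head. -/
theorem false_of_rooted_pred (H1 : ShortPaths E L) (H2 : NoBicycle E) {v u : V} {c : List V}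
    (hch : (v :: c).IsChain E) (hnd : (v :: c).Nodup)
    (hcl : E ((v :: c).getLast (List.cons_ne_nil _ _)) v) (hu : Rooted E u) (huv : E u v)
    (huc : u ∉ v :: c) : False := by
  obtain ⟨y, l', h1, h2, ⟨t, ht⟩, a, ha, hay⟩ := exists_extension H1 (L + 1) u (v :: c)
    (by simp only [List.length_cons]; omega)
    (List.nodup_cons.mpr ⟨huc, hnd⟩) (List.isChain_cons_cons.mpr ⟨huv, hch⟩) hu
  have hlast : (y :: l').getLast (List.cons_ne_nil _ _)
      = (v :: c).getLast (List.cons_ne_nil _ _) := by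
    simp only [← ht]
    rw [List.getLast_append_of_ne_nil _ (List.cons_ne_nil _ _), List.getLast_cons_cons]
  have hv : v ∈ y :: l' := by rw [← ht]; simp
  have hvy := (H2 y l' h1 h2 a ha v hv hay (by rw [hlast]; exact hcl)).2
  cases t with
  | nil =>
    simp only [List.nil_append, List.cons.injEq] at ht
    exact huc (by rw [ht.1, ← hvy]; simp)
  | cons s t =>
    simp only [List.cons_append, List.cons.injEq] at ht
    rw [← hvy, ← ht.2] at h1
    simp at h1

/-- A vertex on a cycle has only one in-neighbour to which a cycle leads. -/
theorem rooted_pred_unique (H1 : ShortPaths E L) (H2 : NoBicycle E) {v u u' : V}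
    (hv : TransGen E v v) (hu : Rooted E u) (huv : E u v) (hu' : Rooted E u') (huv' : E u' v) :
    u = u' := by
  obtain ⟨c, hch, hnd, hcl⟩ := exists_cycle hv
  -- Both in-neighbours are shown to be the predecessor of `v` on one fixed simple cycle.
  suffices H : ∀ u, Rooted E u → E u v → u = (v :: c).getLast (List.cons_ne_nil _ _) by
    rw [H u hu huv, H u' hu' huv']
  intro u hu huv
  by_contra hne
  by_cases hmem : u ∈ v :: c
  · obtain ⟨p, q, hpq⟩ := List.append_of_mem hmem
    have hsplit : v :: c = (p ++ [u]) ++ q := by simp [hpq]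
    have hq : q ≠ [] := by
      rintro rfl
      apply hne
      simp [hpq]
    have hw : (v :: c).getLast (List.cons_ne_nil _ _) ∈ q := by
      simp only [hsplit]
      rw [List.getLast_append_of_ne_nil _ hq]
      exact List.getLast_mem hq
    obtain ⟨p', hp'⟩ : ∃ p', p ++ [u] = v :: p' := by
      cases p with
      | nil => simp only [List.nil_append, List.cons.injEq] at hpq; exact ⟨[], by simp [hpq.1]⟩
      | cons s p =>
        simp only [List.cons_append, List.cons.injEq] at hpq
        exact ⟨p ++ [u], by simp [hpq.1]⟩
    rw [hp'] at hsplit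
    have hlast : (v :: p').getLast (List.cons_ne_nil _ _) = u := by simp [← hp']
    refine false_of_rooted_pred H1 H2 (v := v) (c := p')
      (u := (v :: c).getLast (List.cons_ne_nil _ _)) ?_ ?_ ?_ ?_ hcl ?_
    · rw [hsplit] at hch; exact hch.left_of_append
    · rw [hsplit] at hnd; exact hnd.of_append_left
    · rw [hlast]; exact huv
    · exact ⟨v, hv, (chain_reach v c hch).1⟩
    · intro h
      rw [hsplit] at hnd
      exact (List.disjoint_of_nodup_append hnd) h hw
  · exact false_of_rooted_pred H1 H2 hch hnd hcl hu huv hmem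

theorem exists_repeat_of_walk (H1 : ShortPaths E L) {z : ℕ → V}
    (hz : ∀ i < L, E (z (i + 1)) (z i)) : ∃ i j, i < j ∧ j ≤ L ∧ z i = z j := by
  by_contra hcon
  push Not at hcon
  have hnd : ((List.range (L + 1)).map z).reverse.Nodup := by
    rw [List.nodup_reverse]
    refine List.Nodup.map_on ?_ List.nodup_range
    intro i hi j hj hij
    rw [List.mem_range] at hi hj
    rcases lt_trichotomy i j with h | h | h
    · exact absurd hij (hcon i j h (by omega))
    · exact h
    · exact absurd hij.symm (hcon j i h (by omega))
  have hch : ((List.range (L + 1)).map z).reverse.IsChain E := by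
    rw [List.isChain_reverse, List.isChain_iff_getElem]
    intro i hi
    simp only [List.length_map, List.length_range] at hi
    simp only [List.getElem_map, List.getElem_range]
    exact hz i (by omega)
  have := H1 _ hnd hch
  simp at this

/-- `X t v` is a trajectory in which changes at `v` are due to changes at in-neighbours. -/
def Propagates (E : V → V → Prop) (X : ℕ → V → Bool) : Prop :=
  ∀ v t t', X (t + 1) v ≠ X (t' + 1) v → ∃ u, E u v ∧ X t u ≠ X t' u

variable {X : ℕ → V → Bool}

/-- A difference is traced back to an in-neighbour one step earlier, `k` times; the walk `z` runs
against the edges. -/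
theorem Propagates.exists_walk (hX : Propagates E X) (k : ℕ) (v : V) (t t' : ℕ)
    (h : X (t + k) v ≠ X (t' + k) v) :
    ∃ z : ℕ → V, z 0 = v ∧ (∀ i < k, E (z (i + 1)) (z i)) ∧
      ∀ i j, i + j = k → X (t + j) (z i) ≠ X (t' + j) (z i) := by
  induction k generalizing v with
  | zero =>
    refine ⟨fun _ => v, rfl, fun i hi => absurd hi (by omega), fun i j hij => ?_⟩
    obtain ⟨rfl, rfl⟩ : i = 0 ∧ j = 0 := by omega
    exact h
  | succ k ih =>
    obtain ⟨u, huv, hu⟩ := hX v (t + k) (t' + k) h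
    obtain ⟨z, hz0, hz1, hz2⟩ := ih u hu
    refine ⟨fun i => Nat.casesOn i v z, rfl, fun i hi => ?_, fun i j hij => ?_⟩
    · cases i with
      | zero => simpa [hz0] using huv
      | succ i => exact hz1 i (by omega)
    · cases i with
      | zero =>
        obtain rfl : j = k + 1 := by omega
        exact h
      | succ i => exact hz2 i j (by omega)

/-- A difference at times from `L` on can be traced back `L` steps. Such a walk repeats a vertex, so
it has met a cycle, which leads to `v`. -/
theorem Propagates.rooted (hX : Propagates E X) (H1 : ShortPaths E L) {v : V} {t t' : ℕ}
    (ht : L ≤ t) (ht' : L ≤ t') (h : X t v ≠ X t' v) : Rooted E v := by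
  obtain ⟨s, rfl⟩ := Nat.exists_eq_add_of_le' ht
  obtain ⟨s', rfl⟩ := Nat.exists_eq_add_of_le' ht'
  obtain ⟨z, hz0, hz1, -⟩ := hX.exists_walk L v s s' h
  obtain ⟨i, j, hij, hj, hzz⟩ := exists_repeat_of_walk H1 hz1
  have hcyc := transGen_of_walk hz1 hij hj
  refine ⟨z j, by rw [hzz] at hcyc; exact hcyc, ?_⟩
  rw [← hz0]
  rcases Nat.eq_zero_or_pos j with rfl | h0
  · exact ReflTransGen.refl
  · exact (transGen_of_walk hz1 h0 hj).to_reflTransGen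

/-- From time `L` on, differences occur only at rooted vertices, and a vertex on a cycle has only
one rooted in-neighbour. So a difference can only have come along the chain. -/
theorem Propagates.chain_back (hX : Propagates E X) (H1 : ShortPaths E L) (H2 : NoBicycle E)
    (x : V) (l : List V) (hch : (x :: l).IsChain E) (hx : Rooted E x)
    (hl : ∀ y ∈ l, TransGen E y y) {t t' : ℕ} (ht : L ≤ t) (ht' : L ≤ t')
    (h : X (t + l.length) ((x :: l).getLast (List.cons_ne_nil _ _))
      ≠ X (t' + l.length) ((x :: l).getLast (List.cons_ne_nil _ _))) : X t x ≠ X t' x := by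
  induction l generalizing x t t' with
  | nil => simpa using h
  | cons y l ih =>
    rw [List.isChain_cons_cons] at hch
    have hy := hl y (by simp)
    rw [List.getLast_cons_cons, List.length_cons, add_comm l.length, ← add_assoc,
      ← add_assoc] at h
    have h1 := ih y hch.2 ⟨y, hy, ReflTransGen.refl⟩ (fun w hw => hl w (by simp [hw]))
      (show L ≤ t + 1 by omega) (show L ≤ t' + 1 by omega) h
    obtain ⟨u, huy, hu⟩ := hX y t t' h1
    rw [rooted_pred_unique H1 H2 hy hx hch.1 (hX.rooted H1 ht ht' hu) huy]
    exact hu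

/-- On a cycle of length m, the value at `v` after one revolution is a function of the value before
it, the same function at all times from `L` on. -/
theorem Propagates.cycle_periodic (hX : Propagates E X) (H1 : ShortPaths E L)
    (H2 : NoBicycle E) {v : V} (hv : TransGen E v v) {N : ℕ}
    (hN : ∀ m, 0 < m → m ≤ L → 2 * m ∣ N) {t : ℕ} (ht : 2 * L ≤ t) : X (t + N) v = X t v := by
  obtain ⟨c, hch, hnd, hcl⟩ := exists_cycle hv
  set m := (v :: c).length
  have hm : m ≤ L := H1 _ hnd hch
  have hm' : m = c.length + 1 := rfl
  obtain ⟨hlast, hmem⟩ := chain_reach v c hch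
  have step : ∀ s s', L ≤ s → L ≤ s' → X s v = X s' v → X (s + m) v = X (s' + m) v := by
    intro s s' hs hs' heq
    by_contra hne
    rw [hm', ← add_assoc, ← add_assoc] at hne
    obtain ⟨u, huv, hu⟩ := hX v _ _ hne
    have hru := hX.rooted H1 (by omega) (by omega) hu
    rw [rooted_pred_unique H1 H2 hv hru huv ⟨v, hv, hlast⟩ hcl] at hu
    refine hX.chain_back H1 H2 v c hch ⟨v, hv, ReflTransGen.refl⟩ (fun y hy => ?_) hs hs' hu heq
    obtain ⟨h1, h2⟩ := hmem y hy
    exact (TransGen.tail' h2 hcl).trans_left h1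
  -- A map φ of a two-element set satisfies φ³ = φ. One revolution is used up to reach the image of
  -- φ, hence the start at 2L and the period 2m.
  have period : ∀ s, 2 * L ≤ s → X (s + 2 * m) v = X s v := by
    intro s hs
    obtain ⟨r, rfl⟩ := Nat.exists_eq_add_of_le' (show m ≤ s by omega)
    have hr : L ≤ r := by omega
    have e1 := step r (r + m) hr (by omega)
    have e2 := step r (r + m + m) hr (by omega)
    have e3 := step (r + m) (r + m + m) (by omega) (by omega)
    rw [show r + m + 2 * m = r + m + m + m by ring]
    cases h0 : X r v <;> cases h1 : X (r + m) v <;> cases h2 : X (r + m + m) v <;> simp_all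
  obtain ⟨q, rfl⟩ := hN m (by omega) hm
  clear hN
  induction q with
  | zero => rfl
  | succ q ih => rw [mul_add, mul_one, ← add_assoc, period _ (by omega), ih]

/-- In the absence of long simple paths and of bicycles, trajectories soon become periodic. -/
theorem Propagates.eventually_periodic (hX : Propagates E X) (H1 : ShortPaths E L)
    (H2 : NoBicycle E) : ∃ N > 0, ∀ t, 3 * L ≤ t → X (t + N) = X t := by
  refine ⟨2 * L.factorial, by positivity, fun t ht => ?_⟩
  funext v
  by_contra hne
  obtain ⟨s, rfl⟩ := Nat.exists_eq_add_of_le' (show L ≤ t by omega)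
  rw [add_right_comm] at hne
  -- Tracing a difference back at most `L` steps from time 3L or later reaches a vertex on a cycle
  -- at time at least 2L, where it is already periodic.
  obtain ⟨z, hz0, hz1, hz2⟩ := hX.exists_walk L v _ _ hne
  obtain ⟨i, j, hij, hj, hzz⟩ := exists_repeat_of_walk H1 hz1
  have hcyc := transGen_of_walk hz1 hij hj
  rw [hzz] at hcyc
  refine hz2 j (L - j) (by omega) ?_
  rw [add_right_comm]
  refine hX.cycle_periodic H1 H2 hcyc (fun m h0 hm => ?_) (by omega)
  exact Nat.mul_dvd_mul_left 2 (Nat.dvd_factorial h0 hm)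

end Digraph

/-! ### From the digraph of live inputs to tails -/

theorem Automaton.state_succ (B : Automaton n) (x : Fin n → Bool) (t : ℕ) :
    B.state x (t + 1) = B.step (B.state x t) := by
  unfold Automaton.state; rw [Function.iterate_succ_apply']

theorem Automaton.state_add_period {B : Automaton n} {x : Fin n → Bool} {s N : ℕ}
    (h : B.state x (s + N) = B.state x s) (t : ℕ) :
    B.state x (s + t + N) = B.state x (s + t) := by
  induction t with
  | zero => exact h
  | succ t ih =>
    rw [← add_assoc, add_right_comm, Automaton.state_succ, ih, ← Automaton.state_succ]

theorem Automaton.state_add_mul_period {B : Automaton n} {x : Fin n → Bool} {s N : ℕ}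
    (h : B.state x (s + N) = B.state x s) (t k : ℕ) :
    B.state x (s + t + k * N) = B.state x (s + t) := by
  induction k with
  | zero => simp
  | succ k ih =>
    rw [add_mul, one_mul, ← add_assoc, ← ih, add_assoc s t]
    exact Automaton.state_add_period h _

/-- A state that recurs lies on the state cycle. If it occurred before `entryTime`, it would occur
again within the first revolution, so that some repetition would precede `repeatTime`. -/
theorem Automaton.entryTime_le {B : Automaton n} {x : Fin n → Bool} {s N : ℕ} (hN : 0 < N)
    (h : B.state x (s + N) = B.state x s) : B.entryTime x ≤ s := by
  classical
  obtain ⟨h1, h2⟩ : B.entryTime x < B.repeatTime x ∧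
      B.state x (B.entryTime x) = B.state x (B.repeatTime x) := Nat.find_spec (B.exists_entry x)
  by_contra hlt
  push Not at hlt
  set e := B.entryTime x
  obtain ⟨p, hp⟩ := Nat.exists_eq_add_of_lt h1
  have hper : B.state x (e + (p + 1)) = B.state x e := by rw [← add_assoc, ← hp, h2]
  obtain ⟨r, hr⟩ := Nat.exists_eq_add_of_lt hlt
  -- a state at a time on the cycle that equals the one at time `s`
  have hs : B.state x (s + e * N) = B.state x s := by
    simpa using Automaton.state_add_mul_period h 0 e
  have hge : e ≤ s + e * N := (Nat.le_mul_of_pos_right e hN).trans (Nat.le_add_left _ _)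
  obtain ⟨w, hw⟩ := Nat.exists_eq_add_of_le hge
  have hmod : B.state x (e + w % (p + 1)) = B.state x s := by
    rw [← hs, hw]
    conv_rhs => rw [← Nat.mod_add_div w (p + 1), ← add_assoc, mul_comm (p + 1)]
    exact (Automaton.state_add_mul_period hper _ _).symm
  have hlt' : e + w % (p + 1) < B.repeatTime x := by
    have := Nat.mod_lt w (show 0 < p + 1 by omega)
    omega
  exact Nat.find_min (B.exists_repeat x) hlt' ⟨s, by omega, hmod.symm⟩

theorem Automaton.ncard_tail_le (B : Automaton n) (x : Fin n → Bool) :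
    (B.tail x).ncard ≤ B.entryTime x := by
  have : B.tail x = (B.state x) '' (Finset.range (B.entryTime x) : Set ℕ) := by
    ext y; simp [Automaton.tail]
  rw [this]
  refine (Set.ncard_image_le (Finset.finite_toSet _)).trans ?_
  rw [Set.ncard_coe_finset, Finset.card_range]

theorem Automaton.compat_state (B : Automaton n) (x : Fin n → Bool) (τ : ℕ) :
    ∀ t ≥ τ, ∀ i, Compat (status B ∅ τ i) (B.state x t i) := by
  induction τ with
  | zero => intro t _ i b hb; cases hb
  | succ τ ih =>
    intro t ht i b hb
    obtain ⟨t, rfl⟩ : ∃ s, t = s + 1 := ⟨t - 1, by omega⟩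
    simp only [status, Finset.notMem_empty, if_false] at hb
    rw [force_eq_some_iff] at hb
    rw [Automaton.state_succ]
    exact hb _ _ (ih t (by omega) _) (ih t (by omega) _)

/-- The gate `u` is an input of the gate `v` that may matter once the statuses at time `d` are
in force. -/
def liveEdge (B : Automaton n) (d : ℕ) (u v : Fin n) : Prop :=
  LiveInput (status B ∅ d) (B v) u

theorem Automaton.propagates (B : Automaton n) (x : Fin n → Bool) (d : ℕ) :
    Propagates (liveEdge B d) (fun t => B.state x (d + t)) := by
  intro v t t' hne
  by_contra hcon
  push Not at hcon
  refine hne ?_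
  change B.state x (d + t + 1) v = B.state x (d + t' + 1) v
  rw [Automaton.state_succ, Automaton.state_succ]
  unfold Automaton.step
  set j := (B v).1.val.1
  set k := (B v).1.val.2
  set f := (B v).2
  have hk := B.compat_state x d (d + t) (by omega) k
  have hj := B.compat_state x d (d + t') (by omega) j
  -- The arguments are switched one after the other: the first with the second held at its value at
  -- `t`, then the second with the first held at its value at `t'`. Both values agree with the
  -- statuses.
  have e1 : f (B.state x (d + t) j) (B.state x (d + t) k)
      = f (B.state x (d + t') j) (B.state x (d + t) k) := by
    by_cases hl : LiveFst f (status B ∅ d k)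
    · have := hcon j (Or.inl ⟨rfl, hl⟩)
      rw [this]
    · have h : f false (B.state x (d + t) k) = f true (B.state x (d + t) k) := by
        by_contra h; exact hl ⟨_, hk, h⟩
      cases B.state x (d + t) j <;> cases B.state x (d + t') j <;> simp [h]
  have e2 : f (B.state x (d + t') j) (B.state x (d + t) k)
      = f (B.state x (d + t') j) (B.state x (d + t') k) := by
    by_cases hl : LiveSnd f (status B ∅ d j)
    · have := hcon k (Or.inr ⟨rfl, hl⟩)
      rw [this]
    · have h : f (B.state x (d + t') j) false = f (B.state x (d + t') j) true := by
        by_contra h; exact hl ⟨_, hj, h⟩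
      cases B.state x (d + t) k <;> cases B.state x (d + t') k <;> simp [h]
  rw [e1, e2]

theorem Automaton.ncard_tail_le_of_sparse {B : Automaton n} {d L : ℕ}
    (H1 : ShortPaths (liveEdge B d) L) (H2 : NoBicycle (liveEdge B d)) (x : Fin n → Bool) :
    (B.tail x).ncard ≤ d + 3 * L := by
  obtain ⟨N, hN, h⟩ := (B.propagates x d).eventually_periodic H1 H2
  refine (B.ncard_tail_le x).trans (Automaton.entryTime_le hN ?_)
  have := h (3 * L) le_rfl
  simpa only [← add_assoc] using this

/-! ### First moment bounds for paths and bicycles -/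

theorem exists_path_of_chain {V : Type*} {E : V → V → Prop} {l : List V} {k : ℕ}
    (hl : l.length = k + 1) (hnd : l.Nodup) (hch : l.IsChain E) :
    ∃ w : Fin (k + 1) → V, Function.Injective w ∧ (∀ i : Fin k, E (w i.castSucc) (w i.succ)) ∧
      ∀ i, w i = l[i.val]'(by omega) := by
  refine ⟨fun i => l[i.val]'(by omega), fun i j hij => ?_, fun i => ?_, fun i => rfl⟩
  · exact Fin.ext ((hnd.getElem_inj_iff).mp hij)
  · rw [List.isChain_iff_getElem] at hch
    exact hch i.val (by omega)

/-- `w` is a simple path with `k` edges. -/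
def HasPath (E : Fin n → Fin n → Prop) (k : ℕ) (w : Fin (k + 1) → Fin n) : Prop :=
  Function.Injective w ∧ ∀ i : Fin k, E (w i.castSucc) (w i.succ)

theorem exists_path_of_not_shortPaths {E : Fin n → Fin n → Prop} {L : ℕ}
    (h : ¬ ShortPaths E L) : ∃ w, HasPath E L w := by
  unfold ShortPaths at h
  push Not at h
  obtain ⟨l, hnd, hch, hl⟩ := h
  obtain ⟨w, h1, h2, -⟩ := exists_path_of_chain (l := l.take (L + 1)) (k := L)
    (by rw [List.length_take]; omega) (hnd.sublist (List.take_sublist _ _))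
    (hch.take (L + 1))
  exact ⟨w, h1, h2⟩

/-- A path with two more edges that lead from its vertex `i` to its first vertex and from its last
vertex to its vertex `j`. -/
def HasBicycle (E : Fin n → Fin n → Prop) (k : ℕ) (w : Fin (k + 1) → Fin n)
    (i j : Fin (k + 1)) : Prop :=
  HasPath E k w ∧ ¬ (i = Fin.last k ∧ j = 0) ∧ E (w i) (w 0) ∧ E (w (Fin.last k)) (w j)

theorem exists_bicycle_of_not_noBicycle {E : Fin n → Fin n → Prop} {L : ℕ}
    (h1 : ShortPaths E L) (h2 : ¬ NoBicycle E) :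
    ∃ k < L, ∃ w i j, HasBicycle E k w i j := by
  unfold NoBicycle at h2
  push Not at h2
  obtain ⟨x, l, hnd, hch, a, ha, b, hb, hax, hlb, hne⟩ := h2
  have hlen := h1 _ hnd hch
  obtain ⟨w, hw1, hw2, hw3⟩ := exists_path_of_chain (k := l.length) rfl hnd hch
  obtain ⟨i, hi, rfl⟩ := List.getElem_of_mem ha
  obtain ⟨j, hj, rfl⟩ := List.getElem_of_mem hb
  have hlast : (x :: l).getLast (List.cons_ne_nil _ _) = w (Fin.last l.length) := by
    rw [hw3, List.getLast_eq_getElem]; rfl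
  have hx : x = w 0 := by rw [hw3]; rfl
  have hwi : (x :: l)[i] = w ⟨i, hi⟩ := by rw [hw3]
  have hwj : (x :: l)[j] = w ⟨j, hj⟩ := by rw [hw3]
  rw [hlast] at hlb hne
  rw [hwi] at hax hne
  rw [hwj] at hlb hne
  refine ⟨l.length, by simpa using hlen, w, ⟨i, hi⟩, ⟨j, hj⟩, ⟨hw1, hw2⟩, ?_, ?_, hlb⟩
  · rintro ⟨e1, e2⟩
    refine hne (by rw [e1]) ?_
    rw [e2, ← hx]
  · rw [← hx]; exact hax

/-- The automaton is typical: the gates have small outdegrees, and the statuses at time `d` have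
the proportions `π` up to `ε`. -/
def Typical (d D : ℕ) (π : Option Bool → ℝ) (ε : ℝ) (B : Automaton n) : Prop :=
  SmallOutdegree D B ∧ Balanced (status B ∅ d) π ε

theorem Typical.balanced_leave_out {d D : ℕ} {π : Option Bool → ℝ} {ε : ℝ} {B : Automaton n}
    (h : Typical d D π ε B) {R : Finset (Fin n)} {L : ℕ} (hR : R.card ≤ L)
    (hL : ((L * (1 + D) ^ d : ℕ) : ℝ) ≤ ε * n) : Balanced (status B R d) π (ε + ε) := by
  refine h.2.of_eq_off (reach B R d) (status_eq_of_notMem_reach B R d) (le_trans ?_ hL)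
  exact_mod_cast (card_reach_le h.1 R d).trans (Nat.mul_le_mul_right _ hR)

theorem balanced_ignores (R : Finset (Fin n)) (d : ℕ) (π : Option Bool → ℝ) (ε : ℝ) :
    Ignores R (fun B : Automaton n => Balanced (status B R d) π ε) := by
  intro v hv B g
  have := status_ignores R d v hv B g
  simp only at this
  simp only [this]

theorem liveInput_ignores (R : Finset (Fin n)) (d : ℕ) (u : Fin n) :
    Ignores R (fun (B : Automaton n) (g : Gate n) => LiveInput (status B R d) g u) := by
  intro v hv B g
  have := status_ignores R d v hv B g
  simp only at this
  simp only [this]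

section FirstMoment

variable {d D L : ℕ} {π : Option Bool → ℝ} {ε q : ℝ}

/-- With all gates of the path left out, the `k` edges are constraints on `k` distinct gates,
independent given the statuses. -/
theorem pr_hasPath_le (ha : IsSymmetricDistribution a) (hn : 2 ≤ n) (hq0 : 0 ≤ q)
    (hq : ∀ s : Fin n → Option Bool, Balanced s π (ε + ε) →
      ∀ t, gateMean a (fun g => ind (LiveInput s g t)) ≤ q / n)
    {k : ℕ} (hk : k + 1 ≤ L) (hL : ((L * (1 + D) ^ d : ℕ) : ℝ) ≤ ε * n)
    (w : Fin (k + 1) → Fin n) :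
    pr a n (fun B => Typical d D π ε B ∧ HasPath (liveEdge B d) k w) ≤ (q / n) ^ k := by
  by_cases hw : Function.Injective w
  swap
  · have : pr a n (fun B => Typical d D π ε B ∧ HasPath (liveEdge B d) k w) ≤ 0 := by
      rw [pr_eq, ← expect_const (n := n) ha hn 0]
      refine expect_mono ha fun B => ?_
      rw [ind_false fun h => hw h.2.1]
    exact this.trans (by positivity)
  set P := Finset.univ.image w
  have hwP : ∀ i, w i ∈ P := fun i => Finset.mem_image_of_mem _ (Finset.mem_univ i)
  have hPcard : P.card ≤ L := by
    refine (Finset.card_image_le).trans ?_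
    simpa using hk
  -- No edge of the path enters its first vertex, so the gate `w 0` carries the trivial constraint,
  -- with bound 1.
  have key := pr_forall_le_prod ha hn hw hwP
    (good := fun B => Balanced (status B P d) π (ε + ε))
    (con := Fin.cases (fun _ _ => True)
      (fun i B g => LiveInput (status B P d) g (w i.castSucc)))
    (c := Fin.cases 1 (fun _ => q / n))
    (balanced_ignores P d π _)
    (fun i => by
      cases i using Fin.cases with
      | zero => intro v _ B g; rfl
      | succ i => exact liveInput_ignores P d _)
    (fun B hB i => by
      cases i using Fin.cases with
      | zero =>
        simp only [Fin.cases_zero, ind_true trivial]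
        rw [gateMean_const ha hn]
      | succ i => exact hq _ hB _)
    (fun i => by
      cases i using Fin.cases with
      | zero => exact zero_le_one
      | succ i => exact div_nonneg hq0 (by positivity))
  rw [Fin.prod_univ_succ] at key
  simp only [Fin.cases_zero, Fin.cases_succ, Finset.prod_const, Finset.card_univ,
    Fintype.card_fin, one_mul] at key
  refine (pr_mono ha fun B hB => ?_).trans key
  refine ⟨hB.1.balanced_leave_out hPcard hL, fun i => ?_⟩
  cases i using Fin.cases with
  | zero => trivial
  | succ i => exact (hB.2.2 i).leave_out P

/-- A bicycle prescribes k + 2 inputs for k + 1 gates. Excluding the case in which its two extra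
edges coincide ensures that the gate `w j` has two different prescribed inputs, whence one more
factor of order 1/n. -/
theorem pr_hasBicycle_le (ha : IsSymmetricDistribution a) (hn : 2 ≤ n) (hq1 : q ≤ 1)
    (hq : ∀ s : Fin n → Option Bool, Balanced s π (ε + ε) →
      ∀ t, gateMean a (fun g => ind (LiveInput s g t)) ≤ q / n)
    {k : ℕ} (hk : k + 1 ≤ L) (hL : ((L * (1 + D) ^ d : ℕ) : ℝ) ≤ ε * n)
    (w : Fin (k + 1) → Fin n) (i j : Fin (k + 1)) :
    pr a n (fun B => Typical d D π ε B ∧ HasBicycle (liveEdge B d) k w i j)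
      ≤ 4 / ((n - 1) * n ^ (k + 1)) := by
  have hn2 : (2 : ℝ) ≤ n := by exact_mod_cast hn
  have hn1 : (0 : ℝ) < (n : ℝ) - 1 := by linarith
  have hn0 : (0 : ℝ) < n := by linarith
  by_cases hw : Function.Injective w ∧ ¬ (i = Fin.last k ∧ j = 0)
  swap
  · have : pr a n (fun B => Typical d D π ε B ∧ HasBicycle (liveEdge B d) k w i j) ≤ 0 := by
      rw [pr_eq, ← expect_const (n := n) ha hn 0]
      refine expect_mono ha fun B => ?_
      rw [ind_false fun h => hw ⟨h.2.1.1, h.2.2.1⟩]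
    exact this.trans (by positivity)
  obtain ⟨hw, hij⟩ := hw
  set P := Finset.univ.image w
  have hwP : ∀ i, w i ∈ P := fun i => Finset.mem_image_of_mem _ (Finset.mem_univ i)
  have hPcard : P.card ≤ L := by
    refine (Finset.card_image_le).trans ?_
    simpa using hk
  set base : Fin (k + 1) → Automaton n → Gate n → Prop :=
    Fin.cases (fun _ g => HasInput g (w i))
      (fun m B g => LiveInput (status B P d) g (w m.castSucc))
  -- Each gate contributes 1/n. The first has an additional 2, as it is only required to have an
  -- input, live or not, and `w j` an additional 2/(n - 1) for its second input. If `j = 0`, that 2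
  -- is not needed.
  set c : Fin (k + 1) → ℝ := fun m =>
    (if m = j then 2 / ((n : ℝ) - 1) else 1) * (if m = 0 then 2 else 1) * (1 / n)
  have hbase : ∀ m, Ignores P (base m) := by
    intro m
    cases m using Fin.cases with
    | zero => intro v _ B g; rfl
    | succ m => exact liveInput_ignores P d _
  have key := pr_forall_le_prod ha hn hw hwP
    (good := fun B => Balanced (status B P d) π (ε + ε))
    (con := fun m B g => base m B g ∧ (m = j → HasInput g (w (Fin.last k))))
    (c := c)
    (balanced_ignores P d π _)
    (fun m v hv B g => by
      have := hbase m v hv B g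
      simp only [this])
    (fun B hB m => by
      by_cases hm : m = j
      · simp only [hm, if_true, c, true_implies]
        have hpair : ∀ u, u ≠ w (Fin.last k) →
            gateMean a (fun g => ind (HasInput g u ∧ HasInput g (w (Fin.last k))))
              ≤ 2 / (n - 1) * (if j = 0 then 2 else 1) * (1 / n) := by
          intro u hu
          refine (gateMean_inputs_le ha hu).trans ?_
          have e : (2 : ℝ) / (n * (n - 1)) = 2 / (n - 1) * 1 * (1 / n) := by field_simp
          rw [e]
          gcongr
          split_ifs <;> norm_num
        cases j using Fin.cases with
        | zero =>
          exact hpair _ fun h => hij ⟨hw h, rfl⟩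
        | succ j =>
          refine le_trans (gateMean_mono ha fun g => ind_mono fun h => ?_)
            (hpair (w j.castSucc) fun h => (Fin.castSucc_lt_last j).ne (hw h))
          exact ⟨LiveInput.hasInput h.1, h.2⟩
      · simp only [hm, if_false, c, one_mul, false_implies, and_true]
        cases m using Fin.cases with
        | zero =>
          simp only [if_true]
          rw [mul_one_div]
          exact (gateMean_hasInput ha hn (w i)).le
        | succ m =>
          simp only [Fin.succ_ne_zero, if_false, one_mul]
          exact (hq _ hB _).trans (div_le_div_of_nonneg_right hq1 hn0.le))
    (fun m => by simp only [c]; positivity)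
  have hprod : ∏ m, c m = 4 / ((n - 1) * n ^ (k + 1)) := by
    simp only [c]
    rw [Finset.prod_mul_distrib, Finset.prod_mul_distrib]
    simp only [Finset.prod_ite_eq', Finset.mem_univ, if_true, Finset.prod_const,
      Finset.card_univ, Fintype.card_fin]
    rw [div_pow, one_pow]
    field_simp
    norm_num
  rw [hprod] at key
  refine (pr_mono ha fun B hB => ?_).trans key
  refine ⟨hB.1.balanced_leave_out hPcard hL, fun m => ⟨?_, ?_⟩⟩
  · cases m using Fin.cases with
    | zero => exact LiveInput.hasInput hB.2.2.2.1
    | succ m => exact (hB.2.1.2 m).leave_out P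
  · rintro rfl
    exact LiveInput.hasInput hB.2.2.2.2

theorem pr_hasTailLongerThan_le (ha : IsSymmetricDistribution a) (hn : 2 ≤ n) (hq0 : 0 ≤ q)
    (hq1 : q ≤ 1)
    (hq : ∀ s : Fin n → Option Bool, Balanced s π (ε + ε) →
      ∀ t, gateMean a (fun g => ind (LiveInput s g t)) ≤ q / n)
    (hL : (((L + 1) * (1 + D) ^ d : ℕ) : ℝ) ≤ ε * n) {r : ℝ} (hr : (d : ℝ) + 3 * L ≤ r) :
    pr a n (fun B => B.HasTailLongerThan r)
      ≤ pr a n (fun B => ¬ SmallOutdegree D B)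
        + pr a n (fun B => ¬ Balanced (status B ∅ d) π ε)
        + n * q ^ L + L * (4 * L ^ 2 / (n - 1)) := by
  have hn2 : (2 : ℝ) ≤ n := by exact_mod_cast hn
  have hn1 : (0 : ℝ) < (n : ℝ) - 1 := by linarith
  have hn0 : (0 : ℝ) < n := by linarith
  have himp : ∀ B : Automaton n, B.HasTailLongerThan r →
      ((¬ SmallOutdegree D B ∨ ¬ Balanced (status B ∅ d) π ε) ∨
        ∃ w ∈ Finset.univ, Typical d D π ε B ∧ HasPath (liveEdge B d) L w) ∨
        ∃ k ∈ Finset.range L, ∃ x ∈ (Finset.univ :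
          Finset ((Fin (k + 1) → Fin n) × Fin (k + 1) × Fin (k + 1))),
          Typical d D π ε B ∧ HasBicycle (liveEdge B d) k x.1 x.2.1 x.2.2 := by
    rintro B ⟨x, hx⟩
    by_cases hB : Typical d D π ε B
    · by_cases h1 : ShortPaths (liveEdge B d) L
      · by_cases h2 : NoBicycle (liveEdge B d)
        · exfalso
          have : ((B.tail x).ncard : ℝ) ≤ d + 3 * L := by
            exact_mod_cast Automaton.ncard_tail_le_of_sparse h1 h2 x
          linarith
        · obtain ⟨k, hk, w, i, j, h⟩ := exists_bicycle_of_not_noBicycle h1 h2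
          exact Or.inr ⟨k, Finset.mem_range.mpr hk, (w, i, j), Finset.mem_univ _, hB, h⟩
      · obtain ⟨w, hw⟩ := exists_path_of_not_shortPaths h1
        exact Or.inl (Or.inr ⟨w, Finset.mem_univ _, hB, hw⟩)
    · unfold Typical at hB
      exact Or.inl (Or.inl (not_and_or.mp hB))
  have hpath : pr a n (fun B => ∃ w ∈ Finset.univ,
      Typical d D π ε B ∧ HasPath (liveEdge B d) L w) ≤ n * q ^ L := by
    -- There are n^(L+1) choices of the vertices but only L edges, so that one factor n survives.
    calc _ ≤ ∑ w : Fin (L + 1) → Fin n, (q / n) ^ L :=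
          (pr_exists_le_sum ha _ _).trans (Finset.sum_le_sum fun w _ =>
            pr_hasPath_le ha hn hq0 hq le_rfl hL w)
      _ = n * q ^ L := by
          simp only [Finset.sum_const, Finset.card_univ, Fintype.card_fun, Fintype.card_fin,
            nsmul_eq_mul]
          push_cast
          rw [pow_succ, div_pow]
          field_simp
  have hL' : ((L * (1 + D) ^ d : ℕ) : ℝ) ≤ ε * n :=
    le_trans (by exact_mod_cast Nat.mul_le_mul_right _ (Nat.le_succ L)) hL
  have hbi : pr a n (fun B => ∃ k ∈ Finset.range L, ∃ x ∈ (Finset.univ :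
      Finset ((Fin (k + 1) → Fin n) × Fin (k + 1) × Fin (k + 1))),
      Typical d D π ε B ∧ HasBicycle (liveEdge B d) k x.1 x.2.1 x.2.2)
      ≤ (L : ℝ) * (4 * (L : ℝ) ^ 2 / ((n : ℝ) - 1)) := by
    calc _ ≤ ∑ k ∈ Finset.range L, 4 * (L : ℝ) ^ 2 / (n - 1) := by
          refine (pr_exists_le_sum ha _ _).trans (Finset.sum_le_sum fun k hk => ?_)
          rw [Finset.mem_range] at hk
          calc _ ≤ ∑ x : (Fin (k + 1) → Fin n) × Fin (k + 1) × Fin (k + 1),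
                4 / (((n : ℝ) - 1) * n ^ (k + 1)) :=
                (pr_exists_le_sum ha _ _).trans (Finset.sum_le_sum fun x _ =>
                  pr_hasBicycle_le ha hn hq1 hq hk hL' _ _ _)
            _ = 4 * ((k + 1 : ℕ) : ℝ) ^ 2 / (n - 1) := by
                simp only [Finset.sum_const, Finset.card_univ, Fintype.card_prod,
                  Fintype.card_fun, Fintype.card_fin, nsmul_eq_mul]
                push_cast
                field_simp
            _ ≤ 4 * (L : ℝ) ^ 2 / (n - 1) := by
                gcongr
                exact hk
      _ = (L : ℝ) * (4 * (L : ℝ) ^ 2 / ((n : ℝ) - 1)) := by simp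
  refine (pr_mono ha himp).trans ((pr_or_le ha _ _).trans (add_le_add ?_ hbi))
  exact (pr_or_le ha _ _).trans (add_le_add (pr_or_le ha _ _) hpath)

end FirstMoment

/-! ### Choice of the constants -/

theorem exists_tendsto_pr_hasTailLongerThan (ha : IsSymmetricDistribution a)
    (hac : ∑ f ∈ classC, a f < ∑ f ∈ classA, a f) :
    ∃ β : ℝ, Tendsto (fun n : ℕ => pr a n (fun B => B.HasTailLongerThan (β * Real.logb 2 n)))
      atTop (𝓝 0) := by
  set s := sensitivity a with hs
  have hs0 : 0 ≤ s := sensitivity_nonneg ha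
  have hs1 : s < 1 := by rw [hs]; unfold sensitivity; linarith
  set q := (1 + s) / 2 with hqdef
  have hq0 : 0 < q := by linarith
  have hq1 : q < 1 := by linarith
  obtain ⟨d, hd⟩ : ∃ d : ℕ, s ^ d < (1 - s) / 8 :=
    exists_pow_lt_of_lt_one (by linarith) hs1
  -- With L = κ · `logScale n`, this gives q^L ≤ 1/n², which beats the factor n in the bound for
  -- paths.
  obtain ⟨κ, hκ⟩ : ∃ κ : ℕ, q ^ κ < 1 / 4 := exists_pow_lt_of_lt_one (by norm_num) hq1
  -- The choice of `d` adds at most (1 - s)/4 to s, since the unknown proportion enters doubled, and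
  -- 36 · 2ε adds another (1 - s)/4; the total is q.
  set ε := (1 - s) / 288 with hε
  have hε0 : 0 < ε := by linarith
  have hd' : limitStatus a d none ≤ (1 - s) / 8 := (limitStatus_none_le ha d).trans hd.le
  have hlive : ∀ n : ℕ, 2 ≤ n → ∀ σ : Fin n → Option Bool,
      Balanced σ (limitStatus a d) (ε + ε) →
      ∀ t, gateMean a (fun g => ind (LiveInput σ g t)) ≤ q / n := by
    intro n hn σ hσ t
    obtain ⟨h1, h2⟩ := limit_live_le ha (limitStatus_nonneg ha d) (sum_limitStatus ha d)
      (limitStatus_symm ha d)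
    refine (hσ.gateMean_liveInput_le ha hn (by linarith) h1 h2 t).trans ?_
    exact div_le_div_of_nonneg_right (by linarith) (by positivity)
  -- For n ≥ 2, d + 3L = d + 3κ(⌊log₂ n⌋ + 1) is at most (d + 6κ)⌊log₂ n⌋.
  refine ⟨d + 6 * κ, ?_⟩
  have h1 := tendsto_pr_not_smallOutdegree ha
  have h2 := tendsto_pr_not_balanced ha d ε hε0
  have h3 : Tendsto (fun n : ℕ => (n : ℝ) * q ^ (κ * logScale n)) atTop (𝓝 0) := by
    refine squeeze_zero' (Eventually.of_forall fun n => by positivity) ?_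
      tendsto_one_div_atTop_nhds_zero_nat
    filter_upwards [eventually_ge_atTop 1] with n hn
    have hn0 : (0 : ℝ) < n := by positivity
    have hlt : (n : ℝ) ≤ 2 ^ logScale n := by exact_mod_cast (lt_two_pow_logScale n).le
    have hpow : q ^ (κ * logScale n) ≤ (1 / 4) ^ logScale n := by
      rw [pow_mul]; exact pow_le_pow_left₀ (by positivity) hκ.le _
    have h4 : ((1 : ℝ) / 4) ^ logScale n = 1 / (2 ^ logScale n * 2 ^ logScale n) := by
      rw [← mul_pow, div_pow, one_pow]; norm_num
    calc (n : ℝ) * q ^ (κ * logScale n) ≤ n * (1 / (n * n)) := by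
          rw [h4] at hpow
          refine mul_le_mul_of_nonneg_left (hpow.trans ?_) hn0.le
          exact one_div_le_one_div_of_le (by positivity) (by gcongr)
      _ = 1 / n := by field_simp
  have h4 : Tendsto (fun n : ℕ => ((κ * logScale n : ℕ) : ℝ)
      * (4 * ((κ * logScale n : ℕ) : ℝ) ^ 2 / (n - 1))) atTop (𝓝 0) := by
    have h := (tendsto_logScale_pow_div 3).const_mul (8 * (κ : ℝ) ^ 3)
    rw [mul_zero] at h
    refine squeeze_zero' ?_ ?_ h
    · filter_upwards [eventually_ge_atTop 2] with n hn
      have hn2 : (2 : ℝ) ≤ n := by exact_mod_cast hn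
      have : (0 : ℝ) < (n : ℝ) - 1 := by linarith
      positivity
    · filter_upwards [eventually_ge_atTop 2] with n hn
      have hn2 : (2 : ℝ) ≤ n := by exact_mod_cast hn
      have hn1 : (0 : ℝ) < (n : ℝ) - 1 := by linarith
      push_cast
      rw [mul_div_assoc', mul_div_assoc', div_le_div_iff₀ hn1 (by linarith)]
      have hx : (0 : ℝ) ≤ (κ : ℝ) ^ 3 * (logScale n : ℝ) ^ 3 := by positivity
      nlinarith
  have hsum := ((h1.add h2).add h3).add h4
  simp only [add_zero] at hsum
  refine squeeze_zero' (Eventually.of_forall fun n => pr_nonneg ha _) ?_ hsum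
  have hlarge : ∀ᶠ n : ℕ in atTop,
      (((κ * logScale n + 1) * (1 + 2 * logScale n) ^ d : ℕ) : ℝ) ≤ ε * n := by
    have h := (tendsto_logScale_pow_div (d + 1)).const_mul (((κ + 1) * 3 ^ d : ℕ) : ℝ)
    rw [mul_zero] at h
    filter_upwards [h.eventually (gt_mem_nhds hε0), eventually_ge_atTop 1] with n hn hn1
    have hn0 : (0 : ℝ) < n := by positivity
    rw [mul_div_assoc', div_lt_iff₀ hn0] at hn
    refine le_trans ?_ hn.le
    have hl : 1 ≤ logScale n := Nat.le_add_left _ _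
    have : (κ * logScale n + 1) * (1 + 2 * logScale n) ^ d
        ≤ (κ + 1) * 3 ^ d * logScale n ^ (d + 1) := by
      calc _ ≤ ((κ + 1) * logScale n) * (3 * logScale n) ^ d :=
            Nat.mul_le_mul (by nlinarith) (Nat.pow_le_pow_left (by omega) _)
        _ = _ := by rw [mul_pow, pow_succ]; ring
    exact_mod_cast this
  filter_upwards [eventually_ge_atTop 2, hlarge] with n hn hbig
  refine pr_hasTailLongerThan_le ha hn hq0.le hq1.le (hlive n hn) hbig ?_
  have hlog : (Nat.log 2 n : ℝ) ≤ Real.logb 2 n := by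
    exact_mod_cast Real.natLog_le_logb n 2
  have hlog1 : (1 : ℝ) ≤ Nat.log 2 n := by
    exact_mod_cast Nat.le_log_of_pow_le (by norm_num) (by simpa using hn)
  unfold logScale
  push_cast
  have hd0 : (0 : ℝ) ≤ d := by positivity
  have hκ0 : (0 : ℝ) ≤ κ := by positivity
  calc (d : ℝ) + 3 * (κ * (Nat.log 2 n + 1)) ≤ (d + 6 * κ) * Nat.log 2 n := by nlinarith
    _ ≤ (d + 6 * κ) * Real.logb 2 n := mul_le_mul_of_nonneg_left hlog (by positivity)

end BoolCA

theorem theorem4p9 (a : BoolCA.BoolFun → ℝ) (ha : BoolCA.IsSymmetricDistribution a)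
    (hac : ∑ f ∈ BoolCA.classC, a f < ∑ f ∈ BoolCA.classA, a f) :
    ∃ β : ℝ, Tendsto
      (fun n : ℕ => BoolCA.pr a n (fun B => B.HasTailLongerThan (β * Real.logb 2 n)))
      atTop (𝓝 0) :=
  BoolCA.exists_tendsto_pr_hasTailLongerThan ha hac
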